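/- Let $V$ be a Euclidean vector space of dimension $n$ with scalar product $(\,,\,)$, let $\Phi\subset V$ be a (reduced, not necessarily crystallographic) root system spanning $V$ with finite Coxeter group $W$, and let $\Delta=\{\alpha_1,\dots,\alpha_n\}$ be a basis of simple roots. Put $\delta=\frac12\sum_{\alpha\in\Phi^+}\alpha$ and $Ch(\Delta)=\{x\in V : (x,\alpha_i)>0 \text{ for all } i\}$. Let $\mathcal C_\Phi$ be the set of nonzero subspaces of $V$ spanned by some of the roots. A building set associated to $\Phi$ is a set $\mathcal G\subset\mathcal C_\Phi$ which contains all the lines $\mathbb R\alpha$, $\alpha\in\Phi$, and such that every $C\in\mathcal C_\Phi$ is the direct sum of the maximal elements of $\mathcal G$ contained in $C$. Let $\mathcal G$ be a $W$-invariant building set with $V\in\mathcal G$. Let $\mathcal G_{fund}$ (resp. $\mathcal C_{\Phi_{fund}}$) be the set of the elements of $\mathcal G$ (resp. $\mathcal C_\Phi$) spanned by some of the simple roots. The $\mathcal G_{fund}$-decomposition of $B\in\mathcal C_{\Phi_{fund}}$ is $B=A_1\oplus\dots\oplus A_k$, where $A_1,\dots,A_k$ are the maximal elements of $\mathcal G_{fund}$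 contained in $B$. A subset $\mathcal S\subset\mathcal G_{fund}$ is nested if the sum of any two or more pairwise non comparable elements of $\mathcal S$ is not in $\mathcal G_{fund}$; maximal nested sets are the nested sets which are maximal for inclusion. For a subspace $A$ let $\pi_A$ be the orthogonal projection of $\delta$ to $A$. For $A\in\mathcal G_{fund}-\{V\}$ put $\delta_A=\delta-\pi_A$, and put $\delta_V=\delta$. For $B\subset A$ in $\mathcal G_{fund}$ let $R^A_B$ be the quotient of the maximum coefficient of $\pi_A$, written in terms of the simple roots contained in $A$, by the minimum coefficient of $\pi_B$, written in terms of the simple roots contained in $B$. For $j<i$ let $R^i_j$ be the maximum of the numbers $R^A_B$ with $B\subset A$ in $\mathcal G_{fund}$, $\dim A=i$, $\dim B=j$; if there is no such pair, put $R^i_j=1$. Let $0<\epsilon_1<\epsilon_2<\dots<\epsilon_n=a$ be a suitable list, i.e. $\epsilon_i>2R^i_{i-1}\epsilon_{i-1}$ for $i=2,\dots,n$. Let $H_V=\{x : (x,\delta)=a\}$; for $A\in\mathcal G_{fund}-\{V\}$ let $H_A=\{x : (x,\delta_A)=a-\epsilon_{\dim A}\}$; for $B\in\mathcal C_{\Phi_{fund}}-\mathcal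 G_{fund}$ with $\mathcal G_{fund}$-decomposition $B=A_1\oplus\dots\oplus A_k$ let $\overline H_B=\{x : (x,\delta-\sum_{i}\pi_{A_i})=a-\sum_{i}\epsilon_{\dim A_i}\}$. Let $HS_A$ and $\overline{HS}_B$ be the closed half-spaces that contain the origin and are bounded by $H_A$ and $\overline H_B$ (the right-hand sides are positive, so they are given by the inequality $\le$). The permutonestohedron $P_{\mathcal G}(\Phi)$ is the intersection of all $\sigma HS_A$ and $\sigma\overline{HS}_B$ with $\sigma\in W$, $A\in\mathcal G_{fund}$, $B\in\mathcal C_{\Phi_{fund}}-\mathcal G_{fund}$. The nestohedron $P_{\mathcal G_{fund}}$ is the intersection of $H_V$ with all $HS_A$, $A\in\mathcal G_{fund}-\{V\}$. **Theorem.** $P_{\mathcal G}(\Phi)$ is bounded (hence a polytope). For every $\sigma\in W$ the nestohedron $\sigma P_{\mathcal G_{fund}}$ lies inside the open chamber $\sigma\, Ch(\Delta)$, and $P_{\mathcal G}(\Phi)$ coincides with the convex hull of all the nestohedra $\sigma P_{\mathcal G_{fund}}$, $\sigma\in W$. For every maximal nested set $\mathcal S$ of $\mathcal G_{fund}$ the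 intersection $\bigcap_{A\in\mathcal S}H_A$ is a single point $v_{\mathcal S}$, and the vertices of $P_{\mathcal G}(\Phi)$ are exactly the points $\sigma v_{\mathcal S}$, where $\sigma\in W$ and $\mathcal S$ ranges among the maximal nested sets of $\mathcal G_{fund}$. -/

import Mathlib

open Module Set
open scoped RealInnerProductSpace

namespace Permutonestohedron

section Definitions

variable {V : Type*} [NormedAddCommGroup V] [InnerProductSpace ℝ V]

/-- A (reduced, not necessarily crystallographic) root system in a Euclidean space `V`: a finite
set of nonzero vectors which spans `V`, is stable under the orthogonal reflections in its elements,
and meets every line through a root `α` exactly in `α` and `-α`. -/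
structure IsRootSystem (Φ : Set V) : Prop where
  finite : Φ.Finite
  span_eq_top : Submodule.span ℝ Φ = ⊤
  zero_notMem : (0 : V) ∉ Φ
  reflection_mem : ∀ α ∈ Φ, ∀ β ∈ Φ, (ℝ ∙ α)ᗮ.reflection β ∈ Φ
  reduced : ∀ α ∈ Φ, ∀ t : ℝ, t • α ∈ Φ → t = 1 ∨ t = -1

/-- The basis `Δ = (α₁, …, αₙ)` of `V` is a basis of simple roots for `Φ`: its members are roots and
the coordinates of every root are all nonnegative or all nonpositive. -/
structure IsSimpleSystem {n : ℕ} (Φ : Set V) (Δ : Basis (Fin n) ℝ V) : Prop where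
  mem : ∀ i, Δ i ∈ Φ
  nonneg_or_nonpos : ∀ β ∈ Φ, (∀ i, 0 ≤ Δ.repr β i) ∨ (∀ i, Δ.repr β i ≤ 0)

/-- The Coxeter group `W`, generated by the orthogonal reflections in the roots. -/
def weylGroup (Φ : Set V) : Subgroup (V ≃ₗᵢ[ℝ] V) :=
  Subgroup.closure {s | ∃ α ∈ Φ, s = (ℝ ∙ α)ᗮ.reflection}

/-- The set `C_Φ` of all the (nonzero) subspaces spanned by some of the roots. -/
def spannedSubspaces (Φ : Set V) : Set (Submodule ℝ V) :=
  {C | ∃ T : Set V, T.Nonempty ∧ T ⊆ Φ ∧ C = Submodule.span ℝ T}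

/-- The maximal elements of `G` contained in `C`; they form the `G`-decomposition of `C`. -/
def decomposition (G : Set (Submodule ℝ V)) (C : Submodule ℝ V) : Set (Submodule ℝ V) :=
  {A | Maximal (fun D => D ∈ G ∧ D ≤ C) A}

/-- `G` is a building set associated to the line arrangement `{ℝα | α ∈ Φ}`: it consists of spans of
roots, it contains the lines spanned by the roots, and every span of roots is the
direct sum of the maximal elements of `G` contained in it. -/
structure IsBuildingSet (Φ : Set V) (G : Set (Submodule ℝ V)) : Prop where
  subset : G ⊆ spannedSubspaces Φ
  line_mem : ∀ α ∈ Φ, (ℝ ∙ α) ∈ G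
  sSupIndep_decomposition : ∀ C ∈ spannedSubspaces Φ, sSupIndep (decomposition G C)
  sSup_decomposition : ∀ C ∈ spannedSubspaces Φ, sSup (decomposition G C) = C

/-- `G` is stable under the action of `W` on subspaces. -/
def IsWeylInvariant (Φ : Set V) (G : Set (Submodule ℝ V)) : Prop :=
  ∀ σ ∈ weylGroup Φ, ∀ A ∈ G, A.map (σ.toLinearEquiv : V →ₗ[ℝ] V) ∈ G

/-- The members of `G` that are spanned by some set of simple roots: `G_fund`. -/
def fund {n : ℕ} (Δ : Basis (Fin n) ℝ V) (G : Set (Submodule ℝ V)) : Set (Submodule ℝ V) :=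
  {A | A ∈ G ∧ ∃ I : Set (Fin n), A = Submodule.span ℝ (Δ '' I)}

/-- `S ⊆ G` is nested: the sum of two or more pairwise non comparable elements of `S` never
belongs to `G`. -/
def IsNested (G S : Set (Submodule ℝ V)) : Prop :=
  S ⊆ G ∧ ∀ T ⊆ S, T.Nontrivial → IsAntichain (· ≤ ·) T → sSup T ∉ G

/-- A nested set which is maximal with respect to inclusion. -/
def IsMaximalNested (G S : Set (Submodule ℝ V)) : Prop :=
  Maximal (IsNested G) S

/-- The positive roots with respect to the simple roots `Δ`. -/
def positiveRoots {n : ℕ} (Φ : Set V) (Δ : Basis (Fin n) ℝ V) : Set V :=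
  {β | β ∈ Φ ∧ ∀ i, 0 ≤ Δ.repr β i}

/-- `δ`, half the sum of the positive roots (a finite sum, since `Φ` is finite). -/
noncomputable def delta {n : ℕ} (Φ : Set V) (Δ : Basis (Fin n) ℝ V) : V :=
  (1 / 2 : ℝ) • ∑ᶠ β ∈ positiveRoots Φ Δ, β

/-- The open fundamental chamber. -/
def openChamber {n : ℕ} (Δ : Basis (Fin n) ℝ V) : Set V :=
  {x | ∀ i, 0 < ⟪x, Δ i⟫}

variable [FiniteDimensional ℝ V] {n : ℕ} (Φ : Set V) (Δ : Basis (Fin n) ℝ V)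
  (G : Set (Submodule ℝ V)) (ε : ℕ → ℝ)

/-- `π_A`, the orthogonal projection of `δ` to `A`; in particular `π_V = δ`. -/
noncomputable def piVec (A : Submodule ℝ V) : V :=
  A.starProjection (delta Φ Δ)

/-- The maximum coefficient of `π_A`, written in terms of the simple roots contained in `A`. -/
noncomputable def maxCoeff (A : Submodule ℝ V) : ℝ :=
  ⨆ i : {i : Fin n // Δ i ∈ A}, Δ.repr (piVec Φ Δ A) i

/-- The minimum coefficient of `π_A`, written in terms of the simple roots contained in `A`. -/
noncomputable def minCoeff (A : Submodule ℝ V) : ℝ :=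
  ⨅ i : {i : Fin n // Δ i ∈ A}, Δ.repr (piVec Φ Δ A) i

/-- The set of the ratios `R^A_B`, where `B ⊆ A` range over the members of `G_fund` of dimensions
`j` and `i` respectively. -/
def ratios (i j : ℕ) : Set ℝ :=
  {r | ∃ A ∈ fund Δ G, ∃ B ∈ fund Δ G, B ≤ A ∧ finrank ℝ A = i ∧ finrank ℝ B = j ∧
    r = maxCoeff Φ Δ A / minCoeff Φ Δ B}

open Classical in
/-- `R^i_j`, the maximum of the (finitely many) ratios `R^A_B` with `B ⊆ A` in `G_fund` of dimensions
`j < i`. If there is no such pair, `R^i_j` is `1`, the least value that a ratio can have. -/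
noncomputable def maxRatio (i j : ℕ) : ℝ :=
  if (ratios Φ Δ G i j).Nonempty then sSup (ratios Φ Δ G i j) else 1

/-- `ε₁ < ε₂ < … < εₙ` is a suitable list of positive numbers (only the values of `ε` at `1, …, n`
matter). -/
structure IsSuitable : Prop where
  pos : ∀ i ∈ Icc 1 n, 0 < ε i
  strictMonoOn : StrictMonoOn ε (Icc 1 n)
  lt : ∀ i ∈ Icc 2 n, 2 * maxRatio Φ Δ G i (i - 1) * ε (i - 1) < ε i

open Classical in
/-- `δ_A`, for `A ∈ G_fund`: it is `δ - π_A` if `A ≠ V`, and `δ_V = δ`. -/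
noncomputable def deltaVec (A : Submodule ℝ V) : V :=
  if A = ⊤ then delta Φ Δ else delta Φ Δ - piVec Φ Δ A

open Classical in
/-- The right-hand side of the equation of `H_A`, for `A ∈ G_fund`, where `a = εₙ`. -/
noncomputable def level (n : ℕ) (ε : ℕ → ℝ) (A : Submodule ℝ V) : ℝ :=
  if A = ⊤ then ε n else ε n - ε (finrank ℝ A)

/-- The hyperplane `H_A`, for `A ∈ G_fund`. -/
noncomputable def hyperplane (A : Submodule ℝ V) : Set V :=
  {x | ⟪x, deltaVec Φ Δ A⟫ = level n ε A}

/-- The closed half-space `HS_A` bounded by `H_A` (for a suitable list the level is positive, so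
that this is the side which contains the origin). -/
noncomputable def halfSpace (A : Submodule ℝ V) : Set V :=
  {x | ⟪x, deltaVec Φ Δ A⟫ ≤ level n ε A}

/-- The vector `δ_B = δ - ∑ π_{A_i}`, where `B = A₁ ⊕ … ⊕ A_k` is the `G_fund`-decomposition. -/
noncomputable def deltaBarVec (B : Submodule ℝ V) : V :=
  delta Φ Δ - ∑ᶠ A ∈ decomposition (fund Δ G) B, piVec Φ Δ A

/-- The number `a - ∑ ε_{dim A_i}`, where `B = A₁ ⊕ … ⊕ A_k` is the `G_fund`-decomposition. -/
noncomputable def levelBar (B : Submodule ℝ V) : ℝ :=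
  ε n - ∑ᶠ A ∈ decomposition (fund Δ G) B, ε (finrank ℝ A)

/-- The closed half-space attached to a span `B` of simple roots which is not in `G_fund`; its
boundary is the hyperplane `(x, δ_B) = a - ∑ ε_{dim A_i}`, and the right-hand side is positive for
a suitable list, so that this is the side which contains the origin. -/
noncomputable def halfSpaceBar (B : Submodule ℝ V) : Set V :=
  {x | ⟪x, deltaBarVec Φ Δ G B⟫ ≤ levelBar Δ G ε B}

/-- The permutonestohedron `P_G(Φ)`. -/
noncomputable def permutonestohedron : Set V :=
  (⋂ σ ∈ weylGroup Φ, ⋂ A ∈ fund Δ G, σ '' halfSpace Φ Δ ε A) ∩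
  (⋂ σ ∈ weylGroup Φ, ⋂ B ∈ fund Δ (spannedSubspaces Φ) \ fund Δ G, σ '' halfSpaceBar Φ Δ G ε B)

/-- The nestohedron `P_{G_fund}`: the intersection of `H_V` with the half-spaces `HS_A`, for
`A ∈ G_fund - {V}`. -/
noncomputable def nestohedron : Set V :=
  hyperplane Φ Δ ε ⊤ ∩ ⋂ A ∈ fund Δ G \ {⊤}, halfSpace Φ Δ ε A

end Definitions

end Permutonestohedron

/-!
Write `e I = ε (card I)` for a set `I` of indices of simple roots, and let `c I i` be the coefficients
of `π_I`, the projection of `δ` to the span of the simple roots `α_i`, `i ∈ I`.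

Positivity. The simple roots form obtuse angles and `δ` is strictly dominant, so `c I i > 0` for
`i ∈ I`, the coefficients grow with `I`, and `δ - π_I` is dominant and vanishes exactly on the
`α_i` with `i ∈ I`. If two members of the building set contain nonorthogonal roots, their sum is in
the building set (`IsBuildingSet.sup_mem`). Hence the blocks of a decomposition are orthogonal, so
that the vectors of both families of half-spaces have the form `δ - π_J`; and between members
`I ⊆ J` one can pass by adding one simple root at a time, until only simple roots orthogonal to `I`
are left. So the growth of `ε` between consecutive dimensions yields
`2 ^ (|J| - |I|) * e I * c J i ≤ e J * c I i` for all such pairs and `i ∈ I` (`IsSuitable.key`).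

Vertices. In a maximal nested set `S`, each member `A` has exactly one element `r` in no smaller
member, and every index arises once. The equations `∑ i ∈ A, c A i * u i = e A`, `A ∈ S`, are thus
triangular in the unknowns `u i = (x, α_i)`, with a unique solution (`existsUnique_solution`). The
children of `A` are disjoint and contribute at most `e A / 2` to its equation, so `u` is positive and
`c A r * u r ≥ e A / 2` (`half_le_of_isResidual`). If `A` is the smallest member of `S` containing
a further `D` of the building set, then `r ∈ D`, and the inequality of `D` follows from the single
term of `r` (`le_sum_of_solution`). So `v_S` lies in the nestohedron.

The polytope. By the exchange condition, `(σ x, y) ≤ (x, y)` for dominant `x` and `y`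
(`IsRootSystem.inner_apply_le`), so the nestohedra, which consist of dominant points, lie in
the permutonestohedron. Conversely every linear functional is, up to the action of the group, given
by a dominant `y`, and the barycentric subdivision of the closed chamber writes `y` as a nonnegative
combination of vectors `δ - π_J` for a chain of sets `J` (`IsObtuse.exists_chain_eq_sum`). The
decompositions of these `J` together form a nested set; if a maximal nested set `S` contains it, then
all the inequalities attached to the `J` are equalities at `v_S`, so the functional is maximal there
(`exists_inner_le_vertex`). By separation the permutonestohedron is the convex hull of the finitely
many points `σ v_S`, and each of them is extreme, being the only point where the inequalities attached
to `S` (moved by `σ`) are equalities.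
-/

namespace Permutonestohedron

/-! ### Nested sets of a combinatorial building set -/

section Combinatorics

variable {ι : Type*}

/-- A combinatorial building set on `ι` that contains the whole of `ι`: a family of nonempty finite
sets which contains the singletons and the union of any two intersecting members. -/
structure IsIndexBuilding [Fintype ι] [DecidableEq ι] (B : Set (Finset ι)) : Prop where
  nonempty : ∀ I ∈ B, I.Nonempty
  singleton_mem : ∀ i, {i} ∈ B
  union_mem : ∀ I ∈ B, ∀ J ∈ B, (I ∩ J).Nonempty → I ∪ J ∈ B
  univ_mem : Finset.univ ∈ B

/-- The nested sets of a combinatorial building set. -/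
def IsIndexNested [DecidableEq ι] (B : Set (Finset ι)) (S : Finset (Finset ι)) : Prop :=
  ↑S ⊆ B ∧ ∀ T ⊆ S, (T : Set (Finset ι)).Nontrivial →
    IsAntichain (· ≤ ·) (T : Set (Finset ι)) → T.sup id ∉ B

/-- `i` is a residual element of `A` with respect to `S` if `i ∈ A` and no member of `S` properly
contained in `A` contains `i`. -/
def IsResidual (S : Finset (Finset ι)) (A : Finset ι) (i : ι) : Prop :=
  i ∈ A ∧ ∀ C ∈ S, C ⊂ A → i ∉ C

open Classical in
/-- The maximal members of `S` among those properly contained in `A`. -/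
noncomputable def children (S : Finset (Finset ι)) (A : Finset ι) : Finset (Finset ι) :=
  S.filter fun C => Maximal (fun D => D ∈ S ∧ D ⊂ A) C

open Classical in
/-- The maximal members of `B` contained in `J`. -/
noncomputable def indexDecomposition [Fintype ι] (B : Set (Finset ι)) (J : Finset ι) :
    Finset (Finset ι) :=
  Finset.univ.filter fun C => Maximal (fun D => D ∈ B ∧ D ≤ J) C

lemma mem_children {S : Finset (Finset ι)} {A C : Finset ι} :
    C ∈ children S A ↔ Maximal (fun D => D ∈ S ∧ D ⊂ A) C := by
  simp only [children, Finset.mem_filter, and_iff_right_iff_imp]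
  exact fun h => h.prop.1

lemma mem_indexDecomposition [Fintype ι] {B : Set (Finset ι)} {J C : Finset ι} :
    C ∈ indexDecomposition B J ↔ Maximal (fun D => D ∈ B ∧ D ≤ J) C := by
  simp [indexDecomposition]

lemma isAntichain_children (S : Finset (Finset ι)) (A : Finset ι) :
    IsAntichain (· ≤ ·) (children S A : Set (Finset ι)) := by
  intro C hC D hD hne hle
  exact hne ((mem_children.1 hC).eq_of_le (mem_children.1 hD).prop hle)

lemma exists_mem_children {S : Finset (Finset ι)} {A C : Finset ι} (hC : C ∈ S) (hCA : C ⊂ A) :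
    ∃ D ∈ children S A, C ⊆ D := by
  classical
  obtain ⟨D, hCD, hD⟩ := (S.finite_toSet.subset (fun D (h : D ∈ S ∧ D ⊂ A) => h.1)
    : {D | D ∈ S ∧ D ⊂ A}.Finite).exists_le_maximal (a := C) ⟨hC, hCA⟩
  exact ⟨D, mem_children.2 hD, hCD⟩

variable [Fintype ι] {B : Set (Finset ι)} {S : Finset (Finset ι)}

lemma exists_mem_indexDecomposition {C J : Finset ι} (hC : C ∈ B) (hCJ : C ⊆ J) :
    ∃ D ∈ indexDecomposition B J, C ⊆ D := by
  obtain ⟨D, hCD, hD⟩ := (Set.toFinite {D | D ∈ B ∧ D ≤ J}).exists_le_maximal (a := C) ⟨hC, hCJ⟩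
  exact ⟨D, mem_indexDecomposition.2 hD, hCD⟩

variable [DecidableEq ι]

/-- A building set is closed under adjoining to a member any family of members that meet it. -/
lemma IsIndexBuilding.union_sup_mem (hB : IsIndexBuilding B) {A : Finset ι} (hA : A ∈ B)
    (T : Finset (Finset ι)) (hT : ∀ C ∈ T, C ∈ B ∧ (C ∩ A).Nonempty) : A ∪ T.sup id ∈ B := by
  induction T using Finset.induction_on with
  | empty => simpa
  | insert C T _ ih =>
    have h1 := ih fun D hD => hT D (Finset.mem_insert_of_mem hD)
    obtain ⟨hC, i, hi⟩ := hT C (Finset.mem_insert_self _ _)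
    rw [Finset.mem_inter] at hi
    have h2 := hB.union_mem _ h1 C hC ⟨i, by simp [hi.1, hi.2]⟩
    convert h2 using 1
    rw [Finset.sup_insert]
    ext j
    simp only [Finset.mem_union, Finset.sup_eq_union, id]
    tauto

/-- Two members of a nested set which meet are comparable. -/
lemma IsIndexNested.le_or_le (hB : IsIndexBuilding B) (hS : IsIndexNested B S) {A C : Finset ι}
    (hA : A ∈ S) (hC : C ∈ S) (h : (A ∩ C).Nonempty) : A ⊆ C ∨ C ⊆ A := by
  by_contra! hne
  have hAC : A ≠ C := fun h => hne.1 h.subset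
  refine hS.2 {A, C} (by grind) ?_ ?_ ?_
  · simpa using Set.nontrivial_pair hAC
  · intro X hX Y hY hXY hle
    simp only [Finset.coe_insert, Finset.coe_singleton, Set.mem_insert_iff,
      Set.mem_singleton_iff] at hX hY
    rcases hX with rfl | rfl <;> rcases hY with rfl | rfl
    · exact hXY rfl
    · exact hne.1 hle
    · exact hne.2 hle
    · exact hXY rfl
  · simpa using hB.union_mem A (hS.1 hA) C (hS.1 hC) h

lemma IsIndexNested.exists_isResidual (hB : IsIndexBuilding B) (hS : IsIndexNested B S)
    {A : Finset ι} (hA : A ∈ S) : ∃ i, IsResidual S A i := by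
  by_contra! hne
  have hcov : ∀ i ∈ A, ∃ C ∈ children S A, i ∈ C := by
    intro i hi
    have := hne i
    simp only [IsResidual, not_and, not_forall, not_not] at this
    obtain ⟨C, hC, hCA, hiC⟩ := this hi
    obtain ⟨D, hD, hCD⟩ := exists_mem_children hC hCA
    exact ⟨D, hD, hCD hiC⟩
  have hsup : (children S A).sup id = A := by
    apply le_antisymm
    · exact Finset.sup_le fun C hC => (mem_children.1 hC).prop.2.subset
    · intro i hi
      obtain ⟨C, hC, hiC⟩ := hcov i hi
      exact Finset.mem_sup.2 ⟨C, hC, hiC⟩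
  refine hS.2 (children S A) (fun C hC => (mem_children.1 hC).prop.1) ?_
    (isAntichain_children S A) (by rw [hsup]; exact hS.1 hA)
  obtain ⟨i, hi⟩ := hB.nonempty A (hS.1 hA)
  obtain ⟨C, hC, hiC⟩ := hcov i hi
  obtain ⟨j, hj, hjC⟩ := Finset.exists_of_ssubset (mem_children.1 hC).prop.2
  obtain ⟨D, hD, hjD⟩ := hcov j hj
  exact ⟨C, hC, D, hD, fun h => hjC (h ▸ hjD)⟩

lemma univ_mem_of_maximal (hB : IsIndexBuilding B) (hS : Maximal (IsIndexNested B) S) :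
    Finset.univ ∈ S := by
  have : IsIndexNested B (insert Finset.univ S) := by
    refine ⟨?_, fun T hT hn ha => ?_⟩
    · rw [Finset.coe_insert]
      exact Set.insert_subset hB.univ_mem hS.prop.1
    · refine hS.prop.2 T ?_ hn ha
      intro C hC
      rcases Finset.mem_insert.1 (hT hC) with rfl | h
      · obtain ⟨D, hD, hne⟩ := hn.exists_ne Finset.univ
        exact absurd (Finset.subset_univ D) (ha hD hC hne)
      · exact h
  rw [hS.eq_of_le this (Finset.subset_insert _ _)]
  exact Finset.mem_insert_self _ _

/-- If `i ≠ j` were both residual in `A`, the maximal member of `B` contained in `A \ {i}` and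
containing `j` could be added to `S`. -/
lemma IsResidual.unique (hB : IsIndexBuilding B) (hS : Maximal (IsIndexNested B) S)
    {A : Finset ι} (hA : A ∈ S) {i j : ι} (hi : IsResidual S A i) (hj : IsResidual S A j) :
    i = j := by
  by_contra hij
  obtain ⟨D, hD, hjD⟩ := exists_mem_indexDecomposition (J := A.erase i) (hB.singleton_mem j)
    (by simpa using ⟨fun h => hij h.symm, hj.1⟩)
  rw [Finset.singleton_subset_iff] at hjD
  rw [mem_indexDecomposition] at hD
  have hDA : D ⊂ A := lt_of_le_of_lt hD.prop.2 (Finset.erase_ssubset hi.1)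
  have hDS : D ∉ S := fun h => hj.2 D h hDA hjD
  have hnest : IsIndexNested B (insert D S) := by
    refine ⟨?_, fun T hT hn ha hU => ?_⟩
    · rw [Finset.coe_insert]
      exact Set.insert_subset hD.prop.1 hS.prop.1
    by_cases hDT : D ∈ T
    swap
    · exact hS.prop.2 T (fun C hC => (Finset.mem_insert.1 (hT hC)).resolve_left
        fun h => hDT (h ▸ hC)) hn ha hU
    have hTS : ∀ C ∈ T, C ≠ D → C ∈ S := fun C hC hne =>
      (Finset.mem_insert.1 (hT hC)).resolve_left hne
    -- every other member of `T` is properly contained in `A` or disjoint from `A`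
    have hdich : ∀ C ∈ T, C ≠ D → C ⊂ A ∨ Disjoint C A := by
      intro C hC hne
      by_contra! h
      have hmeet : (C ∩ A).Nonempty := by
        rw [Finset.nonempty_iff_ne_empty, ne_eq, ← Finset.disjoint_iff_inter_eq_empty]
        exact h.2
      rcases hS.prop.le_or_le hB (hTS C hC hne) hA hmeet with h1 | h1
      · rcases h1.eq_or_ssubset with h2 | h2
        · exact ha hDT hC (Ne.symm hne) (h2 ▸ hDA.subset)
        · exact h.1 h2
      · exact ha hDT hC (Ne.symm hne) (hDA.subset.trans h1)
    by_cases hall : ∀ C ∈ T, C ≠ D → C ⊂ A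
    · have hUJ : T.sup id ≤ A.erase i := by
        refine Finset.sup_le fun C hC => ?_
        by_cases hne : C = D
        · exact hne ▸ hD.prop.2
        · have hCA := hall C hC hne
          exact Finset.subset_erase.2 ⟨hCA.subset, hi.2 C (hTS C hC hne) hCA⟩
      have hDU : D = T.sup id := hD.eq_of_le ⟨hU, hUJ⟩ (Finset.le_sup (f := id) hDT)
      obtain ⟨C, hC, hne⟩ := hn.exists_ne D
      exact ha hC hDT hne (by rw [hDU]; exact Finset.le_sup (f := id) hC)
    · push Not at hall
      obtain ⟨C₀, hC₀, hne₀, hC₀A⟩ := hall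
      -- the members of `T` disjoint from `A`, together with `A`, violate nestedness of `S`
      set T' := insert A (T.filter fun C => Disjoint C A) with hT'
      have hmem : ∀ C ∈ T, Disjoint C A → C ∈ S ∧ C ≠ D := by
        intro C hC hd
        have hne : C ≠ D := by
          rintro rfl
          exact Finset.disjoint_left.1 hd hjD hj.1
        exact ⟨hTS C hC hne, hne⟩
      have hd₀ : Disjoint C₀ A := (hdich C₀ hC₀ hne₀).resolve_left hC₀A
      have hnotle : ∀ C ∈ T, Disjoint C A → ¬ C ≤ A ∧ ¬ A ≤ C := by
        intro C hC hd
        constructor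
        · intro h
          obtain ⟨k, hk⟩ := hB.nonempty C (hS.prop.1 (hmem C hC hd).1)
          exact Finset.disjoint_left.1 hd hk (h hk)
        · intro h
          exact Finset.disjoint_left.1 hd (h hj.1) hj.1
      refine hS.prop.2 T' ?_ ?_ ?_ ?_
      · intro C hC
        rcases Finset.mem_insert.1 hC with rfl | h
        · exact hA
        · exact (hmem C (Finset.mem_filter.1 h).1 (Finset.mem_filter.1 h).2).1
      · refine ⟨A, by simp [hT'], C₀, by simp [hT', hC₀, hd₀], ?_⟩
        rintro rfl
        exact (hnotle _ hC₀ hd₀).1 le_rfl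
      · intro X hX Y hY hXY
        simp only [hT', Finset.coe_insert, Finset.coe_filter, Set.mem_insert_iff,
          Set.mem_ofPred_eq] at hX hY
        rcases hX with rfl | hX <;> rcases hY with rfl | hY
        · exact absurd rfl hXY
        · exact (hnotle Y hY.1 hY.2).2
        · exact (hnotle X hX.1 hX.2).1
        · exact ha hX.1 hY.1 hXY
      · have hmeet : (T.sup id ∩ A).Nonempty :=
          ⟨j, Finset.mem_inter.2 ⟨Finset.mem_sup.2 ⟨D, hDT, hjD⟩, hj.1⟩⟩
        convert hB.union_mem _ hU A (hS.prop.1 hA) hmeet using 1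
        ext k
        simp only [hT', Finset.sup_insert, id, Finset.sup_eq_union, Finset.mem_union,
          Finset.mem_sup, Finset.mem_filter]
        constructor
        · rintro (h | ⟨C, ⟨hC, -⟩, hk⟩)
          · exact Or.inr h
          · exact Or.inl ⟨C, hC, hk⟩
        · rintro (⟨C, hC, hk⟩ | h)
          · by_cases hCD : C = D
            · exact Or.inl (hDA.subset (hCD ▸ hk))
            · rcases hdich C hC hCD with h | h
              · exact Or.inl (h.subset hk)
              · exact Or.inr ⟨C, ⟨hC, h⟩, hk⟩
          · exact Or.inl h
  exact hDS (by rw [hS.eq_of_le hnest (Finset.subset_insert _ _)]; exact Finset.mem_insert_self _ _)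

/-- In a maximal nested set every element of `ι` is residual in the smallest member
containing it. -/
lemma exists_isResidual_of_mem (hB : IsIndexBuilding B) (hS : Maximal (IsIndexNested B) S)
    (i : ι) : ∃ A ∈ S, IsResidual S A i := by
  obtain ⟨A, hA⟩ := (S.finite_toSet.subset (fun D (h : D ∈ S ∧ i ∈ D) => h.1)
    : {D | D ∈ S ∧ i ∈ D}.Finite).exists_minimal
      ⟨Finset.univ, univ_mem_of_maximal hB hS, Finset.mem_univ i⟩
  exact ⟨A, hA.prop.1, hA.prop.2, fun C hC hCA hiC => hCA.2 (hA.le_of_le ⟨hC, hiC⟩ hCA.subset)⟩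

/-- A maximal nested set of a building set on `ι` has as many members as `ι` has elements:
a member corresponds to its residual element. -/
lemma card_eq_of_maximal (hB : IsIndexBuilding B) (hS : Maximal (IsIndexNested B) S) :
    Fintype.card S = Fintype.card ι := by
  choose r hr using fun A : S => hS.prop.exists_isResidual hB A.2
  refine Fintype.card_of_bijective (f := r) ⟨fun A C h => ?_, fun i => ?_⟩
  · have hA := hr A
    have hC := hr C
    rw [← h] at hC
    apply Subtype.ext
    rcases hS.prop.le_or_le hB A.2 C.2 ⟨r A, Finset.mem_inter.2 ⟨hA.1, hC.1⟩⟩ with h1 | h1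
    · exact (h1.eq_or_ssubset).resolve_right fun h2 => hC.2 A A.2 h2 hA.1
    · exact ((h1.eq_or_ssubset).resolve_right fun h2 => hA.2 C C.2 h2 hC.1).symm
  · obtain ⟨A, hA, hi⟩ := exists_isResidual_of_mem hB hS i
    exact ⟨⟨A, hA⟩, (hr ⟨A, hA⟩).unique hB hS hA hi⟩

/-- The decompositions of the members of a chain form a nested set. -/
lemma isIndexNested_biUnion_indexDecomposition {F : Finset (Finset ι)}
    (hF : IsChain (· ≤ ·) (F : Set (Finset ι))) :
    IsIndexNested B (F.biUnion (indexDecomposition B)) := by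
  refine ⟨fun C hC => ?_, fun T hT hn ha hU => ?_⟩
  · obtain ⟨J, -, hC⟩ := Finset.mem_biUnion.1 (Finset.mem_coe.1 hC)
    exact (mem_indexDecomposition.1 hC).prop.1
  choose! f hf hfm using fun C (hC : C ∈ T) => Finset.mem_biUnion.1 (hT hC)
  obtain ⟨C₀, hC₀⟩ := hn.nonempty
  obtain ⟨C, hC, hmax⟩ := T.exists_maximalFor f ⟨C₀, hC₀⟩
  have hle : ∀ D ∈ T, f D ≤ f C := by
    intro D hD
    rcases hF.total (hf D hD) (hf C hC) with h | h
    · exact h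
    · exact hmax hD h
  have hUJ : T.sup id ≤ f C := Finset.sup_le fun D hD =>
    (mem_indexDecomposition.1 (hfm D hD)).prop.2.trans (hle D hD)
  have hCU := (mem_indexDecomposition.1 (hfm C hC)).eq_of_le ⟨hU, hUJ⟩ (Finset.le_sup (f := id) hC)
  obtain ⟨D, hD, hne⟩ := hn.exists_ne C
  exact ha hD hC hne (by rw [hCU]; exact Finset.le_sup (f := id) hD)

/-- A member of `B` contained in `A ∈ S`, but in no smaller member of `S`, contains the residual
elements of `A`: otherwise it would be covered by children of `A`, and the union of those that it
meets would belong to `B`. -/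
lemma IsResidual.mem_of_subset (hB : IsIndexBuilding B) (hS : Maximal (IsIndexNested B) S)
    {A D : Finset ι} (hA : A ∈ S) {i : ι} (hi : IsResidual S A i) (hD : D ∈ B) (hDA : D ⊆ A)
    (hmin : ∀ C ∈ S, C ⊂ A → ¬ D ⊆ C) : i ∈ D := by
  by_contra hiD
  have hcov : ∀ k ∈ D, ∃ C ∈ children S A, k ∈ C := by
    intro k hk
    by_contra! h
    refine hiD (?_ : i ∈ D)
    have : IsResidual S A k := ⟨hDA hk, fun C hC hCA hkC => by
      obtain ⟨E, hE, hCE⟩ := exists_mem_children hC hCA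
      exact h E hE (hCE hkC)⟩
    exact hi.unique hB hS hA this ▸ hk
  set T := (children S A).filter fun C => (C ∩ D).Nonempty with hT
  refine hS.prop.2 T (fun C hC => (mem_children.1 (Finset.mem_filter.1 hC).1).prop.1) ?_
    ((isAntichain_children S A).subset fun C hC => (Finset.mem_filter.1 hC).1) ?_
  · obtain ⟨k, hk⟩ := hB.nonempty D hD
    obtain ⟨C, hC, hkC⟩ := hcov k hk
    have hC' := (mem_children.1 hC).prop
    obtain ⟨l, hl, hlC⟩ := Finset.not_subset.1 (hmin C hC'.1 hC'.2)
    obtain ⟨E, hE, hlE⟩ := hcov l hl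
    exact ⟨C, Finset.mem_filter.2 ⟨hC, k, Finset.mem_inter.2 ⟨hkC, hk⟩⟩,
      E, Finset.mem_filter.2 ⟨hE, l, Finset.mem_inter.2 ⟨hlE, hl⟩⟩, fun h => hlC (h ▸ hlE)⟩
  · have h := hB.union_sup_mem hD T fun C hC =>
      ⟨hS.prop.1 (mem_children.1 (Finset.mem_filter.1 hC).1).prop.1, (Finset.mem_filter.1 hC).2⟩
    rwa [Finset.union_eq_right.2] at h
    intro k hk
    obtain ⟨C, hC, hkC⟩ := hcov k hk
    exact Finset.mem_sup.2
      ⟨C, Finset.mem_filter.2 ⟨hC, k, Finset.mem_inter.2 ⟨hkC, hk⟩⟩, hkC⟩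

lemma sum_two_pow_le_two_pow_sum {κ : Type*} (T : Finset κ) (f : κ → ℕ) (hf : ∀ k ∈ T, 1 ≤ f k) :
    ∑ k ∈ T, 2 ^ f k ≤ 2 ^ ∑ k ∈ T, f k := by
  classical
  induction T using Finset.induction_on with
  | empty => simp
  | insert k T hk ih =>
    rw [Finset.sum_insert hk, Finset.sum_insert hk]
    have ih' := ih fun l hl => hf l (Finset.mem_insert_of_mem hl)
    rcases T.eq_empty_or_nonempty with rfl | ⟨l, hl⟩
    · simp
    have h1 : 1 ≤ f k := hf k (Finset.mem_insert_self _ _)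
    have h2 : 1 ≤ ∑ l ∈ T, f l := (hf l (Finset.mem_insert_of_mem hl)).trans
      (Finset.single_le_sum (fun _ _ => Nat.zero_le _) hl)
    have h3 : 2 ≤ 2 ^ f k := by simpa using Nat.pow_le_pow_right (n := 2) (by norm_num) h1
    have h4 : 2 ≤ 2 ^ ∑ l ∈ T, f l := by
      simpa using Nat.pow_le_pow_right (n := 2) (by norm_num) h2
    rw [pow_add]
    nlinarith

variable {c : Finset ι → ι → ℝ} {e : Finset ι → ℝ}

/-- The equations attached to a maximal nested set form a triangular system: the equation of `A`
determines the unknown indexed by the residual element of `A`. -/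
lemma existsUnique_solution (hB : IsIndexBuilding B) (hS : Maximal (IsIndexNested B) S)
    (hc : ∀ A ∈ B, ∀ i ∈ A, 0 < c A i) :
    ∃! u : ι → ℝ, ∀ A ∈ S, ∑ i ∈ A, c A i * u i = e A := by
  let L : (ι → ℝ) →ₗ[ℝ] (S → ℝ) :=
    { toFun := fun u A => ∑ i ∈ A.1, c A.1 i * u i
      map_add' := fun u v => by ext A; simp [mul_add, Finset.sum_add_distrib]
      map_smul' := fun t u => by ext A; simp [Finset.mul_sum, mul_left_comm] }
  have hinj : Function.Injective L := by
    rw [← LinearMap.ker_eq_bot, LinearMap.ker_eq_bot']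
    intro u hu
    have key : ∀ m, ∀ A ∈ S, A.card = m → ∀ i ∈ A, u i = 0 := by
      intro m
      induction m using Nat.strong_induction_on with
      | _ m ih =>
      intro A hA hm
      obtain ⟨r, hr⟩ := hS.prop.exists_isResidual hB hA
      have hz : ∀ i ∈ A, i ≠ r → u i = 0 := by
        intro i hi hne
        by_contra hui
        refine hne (IsResidual.unique hB hS hA ⟨hi, fun C hC hCA hiC => hui ?_⟩ hr)
        exact ih C.card (hm ▸ Finset.card_lt_card hCA) C hC rfl i hiC
      have h0 : ∑ i ∈ A, c A i * u i = 0 := congrFun hu ⟨A, hA⟩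
      rw [Finset.sum_eq_single_of_mem r hr.1 fun i hi hne => by rw [hz i hi hne, mul_zero]] at h0
      have hur : u r = 0 := (mul_eq_zero.1 h0).resolve_left (hc A (hS.prop.1 hA) r hr.1).ne'
      intro i hi
      by_cases h : i = r
      · rw [h, hur]
      · exact hz i hi h
    ext i
    exact key _ _ (univ_mem_of_maximal hB hS) rfl i (Finset.mem_univ i)
  have hsurj : Function.Surjective L :=
    (LinearMap.injective_iff_surjective_of_finrank_eq_finrank (by
      simpa using (card_eq_of_maximal hB hS).symm)).1 hinj
  obtain ⟨u, hu⟩ := hsurj fun A => e A.1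
  refine ⟨u, fun A hA => congrFun hu ⟨A, hA⟩, fun v hv => hinj ?_⟩
  rw [hu]
  ext A
  exact hv A.1 A.2

/-- In the equation of `A`, the children of `A` contribute at most half of the right-hand side. This
is where the growth of the list `ε` is used; the powers of `2` make up for the number of the
children. -/
lemma half_le_of_isResidual (hB : IsIndexBuilding B) (hS : Maximal (IsIndexNested B) S)
    (hc : ∀ A ∈ B, ∀ i ∈ A, 0 < c A i) (he : ∀ A ∈ B, 0 < e A)
    (key : ∀ A ∈ B, ∀ C ∈ B, C ⊂ A → ∀ i ∈ C,
      (2 : ℝ) ^ A.card * e C * c A i ≤ 2 ^ C.card * e A * c C i)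
    {u : ι → ℝ} (hu : ∀ A ∈ S, ∑ i ∈ A, c A i * u i = e A) (m : ℕ) :
    ∀ A ∈ S, A.card = m → ∀ r, IsResidual S A r →
      e A / 2 ≤ c A r * u r ∧ ∀ i ∈ A, 0 < u i := by
  induction m using Nat.strong_induction_on with
  | _ m ih =>
  intro A hA hm r hr
  have hAB := hS.prop.1 hA
  have hpos : ∀ C ∈ S, C ⊂ A → ∀ i ∈ C, 0 < u i := by
    intro C hC hCA
    obtain ⟨s, hs⟩ := hS.prop.exists_isResidual hB hC
    exact (ih C.card (hm ▸ Finset.card_lt_card hCA) C hC rfl s hs).2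
  have hch : ∀ C ∈ children S A, C ∈ S ∧ C ⊂ A := fun C hC => (mem_children.1 hC).prop
  have hdisj : (children S A : Set (Finset ι)).PairwiseDisjoint id := by
    intro C hC D hD hne
    by_contra h
    have hmeet : (C ∩ D).Nonempty := by
      rw [Finset.nonempty_iff_ne_empty, ne_eq, ← Finset.disjoint_iff_inter_eq_empty]
      exact h
    rcases hS.prop.le_or_le hB (hch C hC).1 (hch D hD).1 hmeet with h1 | h1
    · exact isAntichain_children S A hC hD hne h1
    · exact isAntichain_children S A hD hC (Ne.symm hne) h1
  have hA_eq : A = insert r ((children S A).biUnion id) := by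
    ext i
    simp only [Finset.mem_insert, Finset.mem_biUnion, id]
    constructor
    · intro hi
      by_contra! h
      refine h.1 (IsResidual.unique hB hS hA ⟨hi, fun C hC hCA hiC => ?_⟩ hr)
      obtain ⟨D, hD, hCD⟩ := exists_mem_children hC hCA
      exact h.2 D hD (hCD hiC)
    · rintro (rfl | ⟨C, hC, hi⟩)
      · exact hr.1
      · exact (hch C hC).2.subset hi
  have hr_not : r ∉ (children S A).biUnion id := by
    simp only [Finset.mem_biUnion, id, not_exists, not_and]
    exact fun C hC => hr.2 C (hch C hC).1 (hch C hC).2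
  have hcard : A.card = (∑ C ∈ children S A, C.card) + 1 := by
    conv_lhs => rw [hA_eq]
    rw [Finset.card_insert_of_notMem hr_not, Finset.card_biUnion hdisj]
    rfl
  have hsum : ∑ i ∈ A, c A i * u i =
      c A r * u r + ∑ C ∈ children S A, ∑ i ∈ C, c A i * u i := by
    have : ∑ i ∈ A, c A i * u i = ∑ i ∈ insert r ((children S A).biUnion id), c A i * u i := by
      rw [← hA_eq]
    rw [this, Finset.sum_insert hr_not, Finset.sum_biUnion hdisj]
    rfl
  have hchild : ∀ C ∈ children S A,
      (2 : ℝ) ^ A.card * ∑ i ∈ C, c A i * u i ≤ 2 ^ C.card * e A := by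
    intro C hC
    obtain ⟨hCS, hCA⟩ := hch C hC
    have heC := he C (hS.prop.1 hCS)
    refine le_of_mul_le_mul_right ?_ heC
    calc (2 : ℝ) ^ A.card * (∑ i ∈ C, c A i * u i) * e C
        = ∑ i ∈ C, ((2 : ℝ) ^ A.card * e C * c A i) * u i := by
          rw [Finset.mul_sum, Finset.sum_mul]
          exact Finset.sum_congr rfl fun i _ => by ring
      _ ≤ ∑ i ∈ C, (2 ^ C.card * e A * c C i) * u i :=
          Finset.sum_le_sum fun i hi => mul_le_mul_of_nonneg_right
            (key A hAB C (hS.prop.1 hCS) hCA i hi) (hpos C hCS hCA i hi).le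
      _ = 2 ^ C.card * e A * ∑ i ∈ C, c C i * u i := by
          rw [Finset.mul_sum]
          exact Finset.sum_congr rfl fun i _ => by ring
      _ = 2 ^ C.card * e A * e C := by rw [hu C hCS]
  have heA := he A hAB
  have hpow : (∑ C ∈ children S A, (2 : ℝ) ^ C.card) ≤ 2 ^ ∑ C ∈ children S A, C.card := by
    exact_mod_cast sum_two_pow_le_two_pow_sum (children S A) Finset.card fun C hC =>
      (hB.nonempty C (hS.prop.1 (hch C hC).1)).card_pos
  have hbound : ∑ C ∈ children S A, ∑ i ∈ C, c A i * u i ≤ e A / 2 := by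
    have hp : (0 : ℝ) < 2 ^ A.card := by positivity
    refine le_of_mul_le_mul_left ?_ hp
    calc (2 : ℝ) ^ A.card * ∑ C ∈ children S A, ∑ i ∈ C, c A i * u i
        ≤ ∑ C ∈ children S A, 2 ^ C.card * e A := by
          rw [Finset.mul_sum]
          exact Finset.sum_le_sum hchild
      _ = (∑ C ∈ children S A, (2 : ℝ) ^ C.card) * e A := by rw [Finset.sum_mul]
      _ ≤ 2 ^ (∑ C ∈ children S A, C.card) * e A := by gcongr
      _ = 2 ^ A.card * (e A / 2) := by rw [hcard, pow_succ]; ring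
  have hmain : e A / 2 ≤ c A r * u r := by
    have := hu A hA
    rw [hsum] at this
    linarith
  refine ⟨hmain, fun i hi => ?_⟩
  rw [hA_eq, Finset.mem_insert, Finset.mem_biUnion] at hi
  rcases hi with rfl | ⟨C, hC, hi⟩
  · exact pos_of_mul_pos_right (lt_of_lt_of_le (half_pos heA) hmain) (hc A hAB _ hr.1).le
  · exact hpos C (hch C hC).1 (hch C hC).2 i hi

/-- The solution of the equations attached to a maximal nested set satisfies the inequalities
attached to all the members of the building set. -/
lemma le_sum_of_solution (hB : IsIndexBuilding B) (hS : Maximal (IsIndexNested B) S)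
    (hc : ∀ A ∈ B, ∀ i ∈ A, 0 < c A i) (he : ∀ A ∈ B, 0 < e A)
    (key : ∀ A ∈ B, ∀ C ∈ B, C ⊂ A → ∀ i ∈ C,
      (2 : ℝ) ^ A.card * e C * c A i ≤ 2 ^ C.card * e A * c C i)
    {u : ι → ℝ} (hu : ∀ A ∈ S, ∑ i ∈ A, c A i * u i = e A) {D : Finset ι} (hD : D ∈ B) :
    e D ≤ ∑ i ∈ D, c D i * u i := by
  by_cases hDS : D ∈ S
  · exact (hu D hDS).ge
  obtain ⟨A, hA⟩ := (S.finite_toSet.subset (fun C (h : C ∈ S ∧ D ⊆ C) => h.1)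
    : {C | C ∈ S ∧ D ⊆ C}.Finite).exists_minimal
      ⟨Finset.univ, univ_mem_of_maximal hB hS, Finset.subset_univ D⟩
  obtain ⟨hAS, hDA⟩ := hA.prop
  have hAB := hS.prop.1 hAS
  have hDA' : D ⊂ A := hDA.ssubset_of_ne fun h => hDS (h ▸ hAS)
  obtain ⟨r, hr⟩ := hS.prop.exists_isResidual hB hAS
  have hrD : r ∈ D := hr.mem_of_subset hB hS hAS hD hDA fun C hC hCA hDC =>
    hCA.2 (hA.le_of_le ⟨hC, hDC⟩ hCA.subset)
  obtain ⟨hhalf, hpos⟩ := half_le_of_isResidual hB hS hc he key hu _ A hAS rfl r hr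
  have h1 : c D r * u r ≤ ∑ i ∈ D, c D i * u i :=
    Finset.single_le_sum (f := fun i => c D i * u i)
      (fun i hi => (mul_pos (hc D hD i hi) (hpos i (hDA hi))).le) hrD
  refine le_trans ?_ h1
  have hk := key A hAB D hD hDA' r hrD
  have hur := hpos r hr.1
  have heA := he A hAB
  have heD := he D hD
  obtain ⟨d, hd⟩ := Nat.exists_eq_add_of_lt (Finset.card_lt_card hDA')
  have h2 : (2 : ℝ) * e D * c A r ≤ e A * c D r := by
    have hp : (0 : ℝ) < 2 ^ D.card := by positivity
    have hp1 : (1 : ℝ) ≤ 2 ^ d := one_le_pow₀ (by norm_num)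
    refine le_of_mul_le_mul_left ?_ hp
    calc (2 : ℝ) ^ D.card * (2 * e D * c A r)
        ≤ 2 ^ d * (2 ^ D.card * (2 * e D * c A r)) := by
          refine le_mul_of_one_le_left ?_ hp1
          have := hc A hAB r hr.1
          positivity
      _ = 2 ^ A.card * e D * c A r := by rw [hd, pow_succ, pow_add]; ring
      _ ≤ 2 ^ D.card * e A * c D r := hk
      _ = 2 ^ D.card * (e A * c D r) := by ring
  refine le_of_mul_le_mul_left ?_ heA
  calc e A * e D = 2 * e D * (e A / 2) := by ring
    _ ≤ 2 * e D * (c A r * u r) := by gcongr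
    _ = 2 * e D * c A r * u r := by ring
    _ ≤ e A * c D r * u r := by gcongr
    _ = e A * (c D r * u r) := by ring

end Combinatorics

/-! ### Obtuse bases and projections of a dominant vector -/

section Obtuse

variable {V : Type*} [NormedAddCommGroup V] [InnerProductSpace ℝ V] {n : ℕ}

/-- The span of the vectors of the basis `Δ` with index in `I`. -/
def simpleSpan (Δ : Basis (Fin n) ℝ V) (I : Finset (Fin n)) : Submodule ℝ V :=
  Submodule.span ℝ (Δ '' I)

variable {Δ : Basis (Fin n) ℝ V}

lemma mem_simpleSpan {I : Finset (Fin n)} {w : V} :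
    w ∈ simpleSpan Δ I ↔ ∀ i ∉ I, Δ.repr w i = 0 := by
  rw [simpleSpan, Basis.mem_span_image]
  constructor
  · intro h i hi
    by_contra h0
    exact hi (h (Finsupp.mem_support_iff.2 h0))
  · intro h i hi
    by_contra h0
    exact Finsupp.mem_support_iff.1 hi (h i h0)

lemma basis_mem_simpleSpan {I : Finset (Fin n)} {i : Fin n} : Δ i ∈ simpleSpan Δ I ↔ i ∈ I := by
  rw [mem_simpleSpan]
  constructor
  · intro h
    by_contra hi
    simpa using h i hi
  · intro h j hj
    rw [Basis.repr_self, Finsupp.single_eq_of_ne]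
    rintro rfl
    exact hj h

lemma simpleSpan_le_simpleSpan {I J : Finset (Fin n)} :
    simpleSpan Δ I ≤ simpleSpan Δ J ↔ I ⊆ J := by
  constructor
  · intro h i hi
    exact basis_mem_simpleSpan.1 (h (basis_mem_simpleSpan.2 hi))
  · intro h
    exact Submodule.span_mono (Set.image_mono (by exact_mod_cast h))

lemma simpleSpan_injective : Function.Injective (simpleSpan Δ) := fun _ _ h =>
  Finset.Subset.antisymm (simpleSpan_le_simpleSpan.1 h.le) (simpleSpan_le_simpleSpan.1 h.ge)

lemma simpleSpan_empty : simpleSpan Δ ∅ = ⊥ := by simp [simpleSpan]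

lemma simpleSpan_univ : simpleSpan Δ Finset.univ = ⊤ := by
  simp [simpleSpan, Δ.span_eq]

lemma finrank_simpleSpan (I : Finset (Fin n)) : finrank ℝ (simpleSpan Δ I) = I.card := by
  classical
  have h := finrank_span_set_eq_card (R := ℝ) (s := Δ '' I)
    (Δ.linearIndependent.linearIndepOn I).id_image
  rw [simpleSpan, h, Set.toFinset_image, Finset.card_image_of_injective _ Δ.injective]
  simp

lemma simpleSpan_sup (T : Finset (Finset (Fin n))) :
    simpleSpan Δ (T.sup id) = T.sup (simpleSpan Δ) := by
  induction T using Finset.induction_on with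
  | empty => simp [simpleSpan_empty]
  | insert C T _ ih =>
    rw [Finset.sup_insert, Finset.sup_insert, ← ih]
    simp [simpleSpan, Set.image_union, Submodule.span_union]

lemma inner_eq_sum_of_mem_simpleSpan {I : Finset (Fin n)} {w : V} (hw : w ∈ simpleSpan Δ I)
    (x : V) : ⟪x, w⟫ = ∑ i ∈ I, Δ.repr w i * ⟪x, Δ i⟫ := by
  conv_lhs => rw [← Δ.sum_repr w]
  rw [inner_sum]
  simp_rw [inner_smul_right]
  refine (Finset.sum_subset (Finset.subset_univ I) fun i _ hi => ?_).symm
  rw [mem_simpleSpan.1 hw i hi, zero_mul]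

/-- `Δ` is obtuse: distinct members form angles that are not acute. -/
def IsObtuse (Δ : Basis (Fin n) ℝ V) : Prop := ∀ i j, i ≠ j → ⟪Δ i, Δ j⟫ ≤ 0

/-- In the span of a part of an obtuse basis, a vector that is dominant with respect to that
part has nonnegative coordinates. -/
lemma IsObtuse.repr_nonneg (hΔ : IsObtuse Δ) {I : Finset (Fin n)} {w : V}
    (hw : w ∈ simpleSpan Δ I) (h : ∀ i ∈ I, 0 ≤ ⟪w, Δ i⟫) (i : Fin n) : 0 ≤ Δ.repr w i := by
  -- split `w = p - m` into its positive and negative parts; then `⟪m, m⟫ ≤ 0`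
  set m : V := ∑ i, max (-Δ.repr w i) 0 • Δ i with hm
  set p : V := ∑ i, max (Δ.repr w i) 0 • Δ i with hp
  have hwpm : w = p - m := by
    conv_lhs => rw [← Δ.sum_repr w]
    rw [hp, hm, ← Finset.sum_sub_distrib]
    refine Finset.sum_congr rfl fun j _ => ?_
    rw [← sub_smul]
    congr 1
    rcases le_total 0 (Δ.repr w j) with h0 | h0
    · rw [max_eq_left h0, max_eq_right (by linarith)]; ring
    · rw [max_eq_right h0, max_eq_left (by linarith)]; ring
  have h1 : 0 ≤ ⟪w, m⟫ := by
    rw [hm, inner_sum]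
    refine Finset.sum_nonneg fun j _ => ?_
    rw [inner_smul_right]
    by_cases hj : j ∈ I
    · exact mul_nonneg (le_max_right _ _) (h j hj)
    · simp [mem_simpleSpan.1 hw j hj]
  have h2 : ⟪p, m⟫ ≤ 0 := by
    rw [hp, hm, sum_inner]
    refine Finset.sum_nonpos fun j _ => ?_
    rw [inner_sum]
    refine Finset.sum_nonpos fun k _ => ?_
    rw [inner_smul_right, real_inner_smul_left]
    by_cases hjk : j = k
    · subst hjk
      rcases le_total 0 (Δ.repr w j) with h0 | h0
      · rw [max_eq_right (a := -Δ.repr w j) (by linarith)]; simp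
      · rw [max_eq_right h0]; simp
    · have := mul_nonpos_of_nonneg_of_nonpos (le_max_right (Δ.repr w j) 0) (hΔ j k hjk)
      exact mul_nonpos_of_nonneg_of_nonpos (le_max_right _ _) this
  have h3 : m = 0 := by
    rw [hwpm, inner_sub_left] at h1
    exact real_inner_self_nonpos.1 (by linarith)
  have h4 := (Fintype.linearIndependent_iff.1 Δ.linearIndependent) _ (hm ▸ h3) i
  have := le_max_left (-Δ.repr w i) 0
  linarith

lemma eq_zero_of_inner_basis {x : V} (h : ∀ i, ⟪x, Δ i⟫ = 0) : x = 0 := by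
  have := inner_eq_sum_of_mem_simpleSpan (Δ := Δ) (I := Finset.univ) (w := x)
    (by simp [simpleSpan_univ]) x
  rw [Finset.sum_eq_zero fun i _ => by rw [h i, mul_zero]] at this
  exact inner_self_eq_zero.1 this

variable [FiniteDimensional ℝ V]

/-- The coordinates with respect to the dual basis, as a linear equivalence. -/
noncomputable def innerCoords (Δ : Basis (Fin n) ℝ V) : V ≃ₗ[ℝ] (Fin n → ℝ) :=
  LinearMap.linearEquivOfInjective (LinearMap.pi fun i => (innerₗ V (Δ i)))
    (by
      rw [← LinearMap.ker_eq_bot, LinearMap.ker_eq_bot']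
      intro x hx
      refine eq_zero_of_inner_basis (Δ := Δ) fun i => ?_
      rw [real_inner_comm]
      exact congrFun hx i)
    (by simp [finrank_eq_card_basis Δ])

@[simp]
lemma innerCoords_apply (x : V) (i : Fin n) : innerCoords Δ x i = ⟪x, Δ i⟫ := by
  rw [real_inner_comm]
  rfl

lemma starProjection_inner_of_mem {d : V} {I : Finset (Fin n)} {i : Fin n} (hi : i ∈ I) :
    ⟪(simpleSpan Δ I).starProjection d, Δ i⟫ = ⟪d, Δ i⟫ := by
  have h := Submodule.starProjection_inner_eq_zero (K := simpleSpan Δ I) d (Δ i)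
    (basis_mem_simpleSpan.2 hi)
  rw [inner_sub_left] at h
  linarith

lemma starProjection_simpleSpan_mem (d : V) (I : Finset (Fin n)) :
    (simpleSpan Δ I).starProjection d ∈ simpleSpan Δ I :=
  Submodule.starProjection_apply_mem _ _

lemma starProjection_simpleSpan_eq {d w : V} {I : Finset (Fin n)} (hw : w ∈ simpleSpan Δ I)
    (h : ∀ i ∈ I, ⟪w, Δ i⟫ = ⟪d, Δ i⟫) : (simpleSpan Δ I).starProjection d = w := by
  refine (Submodule.eq_starProjection_of_mem_of_inner_eq_zero hw fun v hv => ?_)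
  rw [inner_eq_sum_of_mem_simpleSpan hv]
  refine Finset.sum_eq_zero fun i hi => ?_
  rw [inner_sub_left, h i hi, sub_self, mul_zero]

lemma starProjection_simpleSpan_univ (d : V) :
    (simpleSpan Δ Finset.univ).starProjection d = d :=
  starProjection_simpleSpan_eq (by simp [simpleSpan_univ]) fun _ _ => rfl

/-- Orthogonal pieces of the basis contribute independently to the projection. -/
lemma starProjection_simpleSpan_sup {T : Finset (Finset (Fin n))}
    (hT : ∀ A ∈ T, ∀ C ∈ T, A ≠ C → ∀ i ∈ A, ∀ j ∈ C, ⟪Δ i, Δ j⟫ = 0) (d : V) :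
    (simpleSpan Δ (T.sup id)).starProjection d =
      ∑ A ∈ T, (simpleSpan Δ A).starProjection d := by
  refine starProjection_simpleSpan_eq (Submodule.sum_mem _ fun A hA => ?_) fun j hj => ?_
  · exact simpleSpan_le_simpleSpan.2 (Finset.le_sup (f := id) hA)
      (starProjection_simpleSpan_mem d A)
  · obtain ⟨A, hA, hjA⟩ := Finset.mem_sup.1 hj
    rw [id] at hjA
    rw [sum_inner, Finset.sum_eq_single_of_mem A hA, starProjection_inner_of_mem hjA]
    intro C hC hne
    rw [real_inner_comm, inner_eq_sum_of_mem_simpleSpan (starProjection_simpleSpan_mem d C)]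
    refine Finset.sum_eq_zero fun i hi => ?_
    rw [hT A hA C hC hne.symm j hjA i hi, mul_zero]

lemma repr_starProjection_eq_of_orthogonal {I J : Finset (Fin n)} (hIJ : I ⊆ J)
    (h : ∀ i ∈ I, ∀ j ∈ J, j ∉ I → ⟪Δ i, Δ j⟫ = 0) (d : V) {i : Fin n} (hi : i ∈ I) :
    Δ.repr ((simpleSpan Δ J).starProjection d) i =
      Δ.repr ((simpleSpan Δ I).starProjection d) i := by
  have hmem := starProjection_simpleSpan_mem (Δ := Δ) d (J \ I)
  have hK : (simpleSpan Δ J).starProjection d =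
      (simpleSpan Δ I).starProjection d + (simpleSpan Δ (J \ I)).starProjection d := by
    have hne : I ≠ J \ I := by
      intro h0
      have := h0 ▸ hi
      simp [hi] at this
    have := starProjection_simpleSpan_sup (Δ := Δ) (T := {I, J \ I}) (by
      intro A hA C hC hAC k hk l hl
      simp only [Finset.mem_insert, Finset.mem_singleton] at hA hC
      rcases hA with rfl | rfl <;> rcases hC with rfl | rfl
      · exact absurd rfl hAC
      · rw [Finset.mem_sdiff] at hl
        exact h k hk l hl.1 hl.2
      · rw [Finset.mem_sdiff] at hk
        rw [real_inner_comm]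
        exact h l hl k hk.1 hk.2
      · exact absurd rfl hAC) d
    rw [Finset.sum_pair hne] at this
    rw [← this]
    simp [Finset.union_eq_right.2 hIJ]
  rw [hK, map_add, Finsupp.add_apply, mem_simpleSpan.1 hmem i (by simp [hi]), add_zero]

variable {d : V}

lemma IsObtuse.repr_starProjection_nonneg (hΔ : IsObtuse Δ) (hd : ∀ i, 0 < ⟪d, Δ i⟫)
    (I : Finset (Fin n)) (i : Fin n) : 0 ≤ Δ.repr ((simpleSpan Δ I).starProjection d) i :=
  hΔ.repr_nonneg (starProjection_simpleSpan_mem d I)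
    (fun j hj => by rw [starProjection_inner_of_mem hj]; exact (hd j).le) i

lemma IsObtuse.inner_starProjection_nonpos (hΔ : IsObtuse Δ) (hd : ∀ i, 0 < ⟪d, Δ i⟫)
    {I : Finset (Fin n)} {i : Fin n} (hi : i ∉ I) :
    ⟪(simpleSpan Δ I).starProjection d, Δ i⟫ ≤ 0 := by
  rw [real_inner_comm, inner_eq_sum_of_mem_simpleSpan (starProjection_simpleSpan_mem d I)]
  refine Finset.sum_nonpos fun j hj => mul_nonpos_of_nonneg_of_nonpos
    (hΔ.repr_starProjection_nonneg hd I j) (hΔ i j ?_)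
  rintro rfl
  exact hi hj

lemma IsObtuse.repr_starProjection_pos (hΔ : IsObtuse Δ) (hd : ∀ i, 0 < ⟪d, Δ i⟫)
    {I : Finset (Fin n)} {i : Fin n} (hi : i ∈ I) :
    0 < Δ.repr ((simpleSpan Δ I).starProjection d) i := by
  refine (hΔ.repr_starProjection_nonneg hd I i).lt_of_ne' fun h0 => ?_
  have h1 := hd i
  rw [← starProjection_inner_of_mem hi, real_inner_comm,
    inner_eq_sum_of_mem_simpleSpan (starProjection_simpleSpan_mem d I)] at h1
  refine absurd h1 (not_lt.2 (Finset.sum_nonpos fun j _ => ?_))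
  by_cases hij : i = j
  · rw [← hij, h0, zero_mul]
  · exact mul_nonpos_of_nonneg_of_nonpos (hΔ.repr_starProjection_nonneg hd I j) (hΔ i j hij)

lemma IsObtuse.repr_starProjection_mono (hΔ : IsObtuse Δ) (hd : ∀ i, 0 < ⟪d, Δ i⟫)
    {I J : Finset (Fin n)} (hIJ : I ⊆ J) (i : Fin n) :
    Δ.repr ((simpleSpan Δ I).starProjection d) i ≤
      Δ.repr ((simpleSpan Δ J).starProjection d) i := by
  have h := hΔ.repr_nonneg (I := J) (w := (simpleSpan Δ J).starProjection d -
    (simpleSpan Δ I).starProjection d) (Submodule.sub_mem _ (starProjection_simpleSpan_mem d J)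
      (simpleSpan_le_simpleSpan.2 hIJ (starProjection_simpleSpan_mem d I))) (fun j hj => by
        rw [inner_sub_left, starProjection_inner_of_mem hj]
        by_cases hjI : j ∈ I
        · rw [starProjection_inner_of_mem hjI, sub_self]
        · linarith [hd j, hΔ.inner_starProjection_nonpos hd hjI]) i
  rw [map_sub, Finsupp.sub_apply] at h
  linarith

lemma inner_sub_starProjection_eq_zero {I : Finset (Fin n)} {i : Fin n} (hi : i ∈ I) :
    ⟪d - (simpleSpan Δ I).starProjection d, Δ i⟫ = 0 := by
  rw [inner_sub_left, starProjection_inner_of_mem hi, sub_self]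

lemma IsObtuse.inner_sub_starProjection_pos (hΔ : IsObtuse Δ) (hd : ∀ i, 0 < ⟪d, Δ i⟫)
    {I : Finset (Fin n)} {i : Fin n} (hi : i ∉ I) :
    0 < ⟪d - (simpleSpan Δ I).starProjection d, Δ i⟫ := by
  rw [inner_sub_left]
  linarith [hd i, hΔ.inner_starProjection_nonpos hd hi]

lemma IsObtuse.inner_sub_starProjection_nonneg (hΔ : IsObtuse Δ) (hd : ∀ i, 0 < ⟪d, Δ i⟫)
    (I : Finset (Fin n)) (i : Fin n) : 0 ≤ ⟪d - (simpleSpan Δ I).starProjection d, Δ i⟫ := by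
  by_cases hi : i ∈ I
  · rw [inner_sub_starProjection_eq_zero hi]
  · exact (hΔ.inner_sub_starProjection_pos hd hi).le

/-- The closed chamber is subdivided barycentrically: the vector `d - π_J` lies in the relative
interior of the face of the chamber that is orthogonal to the `Δ i` with `i ∈ J`, and every vector of
the chamber is a nonnegative combination of such vectors along a chain of proper subsets `J`. -/
lemma IsObtuse.exists_chain_eq_sum (hΔ : IsObtuse Δ) (hd : ∀ i, 0 < ⟪d, Δ i⟫) (m : ℕ) :
    ∀ y : V, (∀ i, 0 ≤ ⟪y, Δ i⟫) → (Finset.univ.filter fun i => 0 < ⟪y, Δ i⟫).card = m →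
    ∃ (F : Finset (Finset (Fin n))) (t : Finset (Fin n) → ℝ),
      IsChain (· ≤ ·) (F : Set (Finset (Fin n))) ∧ (∀ J ∈ F, J ≠ Finset.univ) ∧
      (∀ J ∈ F, ∀ i, ⟪y, Δ i⟫ = 0 → i ∈ J) ∧ (∀ J, 0 ≤ t J) ∧
      y = ∑ J ∈ F, t J • (d - (simpleSpan Δ J).starProjection d) := by
  induction m using Nat.strong_induction_on with
  | _ m ih =>
  intro y hy hm
  set P := Finset.univ.filter fun i => 0 < ⟪y, Δ i⟫ with hP
  have hmemP : ∀ i, i ∈ P ↔ 0 < ⟪y, Δ i⟫ := fun i => by simp [hP]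
  rcases P.eq_empty_or_nonempty with hPe | hPne
  · refine ⟨∅, 0, by simp, by simp, by simp, by simp, ?_⟩
    rw [Finset.sum_empty]
    refine eq_zero_of_inner_basis (Δ := Δ) fun i => ?_
    refine le_antisymm (not_lt.1 fun h => ?_) (hy i)
    have := (hmemP i).2 h
    simp [hPe] at this
  set p := d - (simpleSpan Δ Pᶜ).starProjection d with hp
  have hpP : ∀ i ∈ P, 0 < ⟪p, Δ i⟫ := fun i hi =>
    hΔ.inner_sub_starProjection_pos hd (by simpa using hi)
  have hpP' : ∀ i ∉ P, ⟪p, Δ i⟫ = 0 := fun i hi =>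
    inner_sub_starProjection_eq_zero (by simpa using hi)
  obtain ⟨k, hk, hmin⟩ := P.exists_min_image (fun i => ⟪y, Δ i⟫ / ⟪p, Δ i⟫) hPne
  set s := ⟪y, Δ k⟫ / ⟪p, Δ k⟫ with hs
  have hs0 : 0 < s := div_pos ((hmemP k).1 hk) (hpP k hk)
  have hyp : ∀ i, ⟪y - s • p, Δ i⟫ = ⟪y, Δ i⟫ - s * ⟪p, Δ i⟫ := fun i => by
    rw [inner_sub_left, real_inner_smul_left]
  have hy'k : ⟪y - s • p, Δ k⟫ = 0 := by
    rw [hyp, hs, div_mul_cancel₀ _ (hpP k hk).ne', sub_self]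
  have hy'P : ∀ i ∉ P, ⟪y - s • p, Δ i⟫ = 0 := by
    intro i hi
    rw [hyp, hpP' i hi, mul_zero, sub_zero]
    exact le_antisymm (not_lt.1 fun h => hi ((hmemP i).2 h)) (hy i)
  have hy' : ∀ i, 0 ≤ ⟪y - s • p, Δ i⟫ := by
    intro i
    by_cases hi : i ∈ P
    · have := (le_div_iff₀ (hpP i hi)).1 (hmin i hi)
      rw [hyp]
      linarith
    · exact (hy'P i hi).ge
  obtain ⟨F, t, hF, hFu, hFz, ht, hsum⟩ := ih _ (by
    rw [← hm]
    refine Finset.card_lt_card (Finset.ssubset_iff_of_subset (fun i hi => ?_) |>.2 ⟨k, hk, ?_⟩)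
    · by_contra hiP
      simp [hy'P i hiP] at hi
    · simp [hy'k]) (y - s • p) hy' rfl
  have hPF : ∀ J ∈ F, Pᶜ ⊆ J := fun J hJ i hi =>
    hFz J hJ i (hy'P i (Finset.mem_compl.1 hi))
  have hPnotF : Pᶜ ∉ F := fun h => by
    have := hFz _ h k hy'k
    simp [hk] at this
  classical
  refine ⟨insert Pᶜ F, Function.update t Pᶜ s, ?_, ?_, ?_, ?_, ?_⟩
  · rw [Finset.coe_insert]
    exact hF.insert fun J hJ _ => Or.inl (hPF J hJ)
  · intro J hJ
    rcases Finset.mem_insert.1 hJ with rfl | hJ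
    · intro h
      rw [Finset.compl_eq_univ_iff] at h
      simp [h] at hPne
    · exact hFu J hJ
  · intro J hJ i hi
    have hiP : i ∈ Pᶜ := by simp [hmemP, hi]
    rcases Finset.mem_insert.1 hJ with rfl | hJ
    · exact hiP
    · exact hPF J hJ hiP
  · intro J
    by_cases h : J = Pᶜ
    · rw [h, Function.update_self]; exact hs0.le
    · rw [Function.update_of_ne h]; exact ht J
  · rw [Finset.sum_insert hPnotF, Function.update_self]
    have : ∑ J ∈ F, Function.update t Pᶜ s J • (d - (simpleSpan Δ J).starProjection d) =
        ∑ J ∈ F, t J • (d - (simpleSpan Δ J).starProjection d) := by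
      refine Finset.sum_congr rfl fun J hJ => ?_
      rw [Function.update_of_ne]
      rintro rfl
      exact hPnotF hJ
    rw [this, ← hsum]
    simp [hp]

lemma IsObtuse.isBounded_dominant (hΔ : IsObtuse Δ) (hd : ∀ i, 0 < ⟪d, Δ i⟫) (a : ℝ) :
    Bornology.IsBounded {x : V | (∀ i, 0 ≤ ⟪x, Δ i⟫) ∧ ⟪x, d⟫ ≤ a} := by
  have hcpos : ∀ i, 0 < Δ.repr d i := fun i => by
    have := hΔ.repr_starProjection_pos hd (Finset.mem_univ i)
    rwa [starProjection_simpleSpan_univ] at this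
  have hK : IsCompact ((innerCoords Δ).symm ''
      (Set.Icc (0 : Fin n → ℝ) fun i => a / Δ.repr d i)) :=
    isCompact_Icc.image (LinearMap.continuous_of_finiteDimensional
      ((innerCoords Δ).symm : (Fin n → ℝ) →ₗ[ℝ] V))
  refine hK.isBounded.subset fun x hx => ⟨innerCoords Δ x, ⟨fun i => ?_, fun i => ?_⟩, by simp⟩
  · simpa using hx.1 i
  · rw [innerCoords_apply, le_div_iff₀ (hcpos i), mul_comm]
    refine le_trans ?_ hx.2
    rw [inner_eq_sum_of_mem_simpleSpan (I := Finset.univ) (w := d) (Δ := Δ)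
      (by simp [simpleSpan_univ])]
    exact Finset.single_le_sum (f := fun i => Δ.repr d i * ⟪x, Δ i⟫)
      (fun j _ => mul_nonneg (hcpos j).le (hx.1 j)) (Finset.mem_univ i)

end Obtuse

/-! ### The Coxeter group and dominance -/

section Weyl

variable {V : Type*} [NormedAddCommGroup V] [InnerProductSpace ℝ V]

lemma reflection_apply_eq (α v : V) :
    (ℝ ∙ α)ᗮ.reflection v = v - (2 * ⟪α, v⟫ / ‖α‖ ^ 2) • α := by
  rw [Submodule.reflection_orthogonal_apply, Submodule.reflection_singleton_apply, neg_sub]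
  congr 1
  rw [two_nsmul, ← add_smul]
  congr 1
  simp
  ring

lemma inner_reflection (α v w : V) :
    ⟪(ℝ ∙ α)ᗮ.reflection v, w⟫ = ⟪v, w⟫ - 2 * ⟪α, v⟫ / ‖α‖ ^ 2 * ⟪α, w⟫ := by
  rw [reflection_apply_eq, inner_sub_left, real_inner_smul_left]

lemma reflection_self (α : V) : (ℝ ∙ α)ᗮ.reflection α = -α :=
  Submodule.reflection_orthogonalComplement_singleton_eq_neg α

/-- Conjugation turns the reflection in `α` into the reflection in the image of `α`. -/
lemma mul_reflection (g : V ≃ₗᵢ[ℝ] V) (α : V) :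
    g * (ℝ ∙ α)ᗮ.reflection = (ℝ ∙ (g α))ᗮ.reflection * g := by
  ext v
  simp only [LinearIsometryEquiv.coe_mul, Function.comp_apply, reflection_apply_eq, map_sub,
    map_smul, LinearIsometryEquiv.inner_map_map, LinearIsometryEquiv.norm_map]

variable {n : ℕ} {Φ : Set V} {Δ : Basis (Fin n) ℝ V}

lemma repr_reflection (i j : Fin n) (v : V) (hij : j ≠ i) :
    Δ.repr ((ℝ ∙ (Δ i))ᗮ.reflection v) j = Δ.repr v j := by
  rw [reflection_apply_eq, map_sub, map_smul, Basis.repr_self]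
  simp [Finsupp.single_eq_of_ne hij]

/-- The product of the simple reflections with the indices listed in `l`. -/
noncomputable def wordProd (Δ : Basis (Fin n) ℝ V) (l : List (Fin n)) : V ≃ₗᵢ[ℝ] V :=
  (l.map fun i => (ℝ ∙ (Δ i))ᗮ.reflection).prod

lemma wordProd_nil : wordProd Δ [] = 1 := rfl

lemma wordProd_cons (i : Fin n) (l : List (Fin n)) :
    wordProd Δ (i :: l) = (ℝ ∙ (Δ i))ᗮ.reflection * wordProd Δ l := by simp [wordProd]

lemma wordProd_append (l l' : List (Fin n)) :
    wordProd Δ (l ++ l') = wordProd Δ l * wordProd Δ l' := by simp [wordProd]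

lemma wordProd_singleton (i : Fin n) : wordProd Δ [i] = (ℝ ∙ (Δ i))ᗮ.reflection := by
  simp [wordProd]

lemma wordProd_inv (l : List (Fin n)) : (wordProd Δ l)⁻¹ = wordProd Δ l.reverse := by
  induction l with
  | nil => simp [wordProd]
  | cons i l ih =>
    rw [wordProd_cons, mul_inv_rev, ih, List.reverse_cons, wordProd_append, wordProd_singleton,
      Submodule.reflection_inv]

lemma IsRootSystem.ne_zero (hΦ : IsRootSystem Φ) {β : V} (hβ : β ∈ Φ) : β ≠ 0 := fun h =>
  hΦ.zero_notMem (h ▸ hβ)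

lemma IsRootSystem.weylGroup_apply_mem (hΦ : IsRootSystem Φ) {σ : V ≃ₗᵢ[ℝ] V}
    (hσ : σ ∈ weylGroup Φ) {β : V} (hβ : β ∈ Φ) : σ β ∈ Φ := by
  have h : ∀ σ ∈ weylGroup Φ, ∀ β ∈ Φ, σ β ∈ Φ := by
    intro σ hσ
    refine Subgroup.closure_induction ?_ ?_ ?_ ?_ hσ
    · rintro _ ⟨α, hα, rfl⟩ β hβ
      exact hΦ.reflection_mem α hα β hβ
    · intro β hβ
      exact hβ
    · intro f g _ _ hf hg β hβ
      exact hf _ (hg β hβ)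
    · -- an injective self-map of the finite set of roots is surjective
      intro f _ hf β hβ
      obtain ⟨γ, hγ, hγβ⟩ := (hΦ.finite.injOn_iff_bijOn_of_mapsTo hf).1
        f.injective.injOn |>.surjOn hβ
      rw [← hγβ]
      simpa using hγ
  exact h σ hσ β hβ

lemma wordProd_mem (hΔ : IsSimpleSystem Φ Δ) (l : List (Fin n)) : wordProd Δ l ∈ weylGroup Φ := by
  refine Subgroup.list_prod_mem _ fun s hs => ?_
  obtain ⟨i, -, rfl⟩ := List.mem_map.1 hs
  exact Subgroup.subset_closure ⟨Δ i, hΔ.mem i, rfl⟩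

lemma reflection_basis_mem (hΔ : IsSimpleSystem Φ Δ) (i : Fin n) :
    (ℝ ∙ (Δ i))ᗮ.reflection ∈ weylGroup Φ :=
  Subgroup.subset_closure ⟨Δ i, hΔ.mem i, rfl⟩

lemma eq_zero_of_nonneg_of_nonpos {β : V} (h1 : ∀ i, 0 ≤ Δ.repr β i)
    (h2 : ∀ i, Δ.repr β i ≤ 0) : β = 0 :=
  Δ.ext_elem fun i => by simpa using le_antisymm (h2 i) (h1 i)

/-- A simple reflection permutes the positive roots other than its own simple root. -/
lemma IsRootSystem.reflection_nonneg (hΦ : IsRootSystem Φ) (hΔ : IsSimpleSystem Φ Δ) {β : V}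
    (hβ : β ∈ Φ) (hpos : ∀ j, 0 ≤ Δ.repr β j) {i : Fin n} (hne : β ≠ Δ i) (j : Fin n) :
    0 ≤ Δ.repr ((ℝ ∙ (Δ i))ᗮ.reflection β) j := by
  obtain ⟨k, hki, hk⟩ : ∃ k, k ≠ i ∧ Δ.repr β k ≠ 0 := by
    by_contra! h
    have hβi : β = Δ.repr β i • Δ i := by
      refine Δ.ext_elem fun k => ?_
      by_cases hk : k = i
      · simp [hk]
      · simp [h k hk, Finsupp.single_eq_of_ne hk]
    have h1 := hΦ.reduced (Δ i) (hΔ.mem i) (Δ.repr β i) (hβi ▸ hβ)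
    rcases h1 with h1 | h1
    · exact hne (by rw [hβi, h1, one_smul])
    · linarith [hpos i]
  rcases hΔ.nonneg_or_nonpos _ (hΦ.reflection_mem _ (hΔ.mem i) β hβ) with h | h
  · exact h j
  · have h1 := h k
    rw [repr_reflection i k β hki] at h1
    exact absurd (le_antisymm h1 (hpos k)) hk

lemma IsRootSystem.isObtuse (hΦ : IsRootSystem Φ) (hΔ : IsSimpleSystem Φ Δ) : IsObtuse Δ := by
  intro i j hij
  have h := hΦ.reflection_nonneg hΔ (hΔ.mem j) (fun k => by
    rw [Basis.repr_self]
    exact Finsupp.single_nonneg.2 zero_le_one k) (i := i) (fun h => hij (Δ.injective h).symm) i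
  rw [reflection_apply_eq, map_sub, map_smul, Basis.repr_self, Basis.repr_self] at h
  simp [Finsupp.single_eq_of_ne hij] at h
  by_contra! hpos
  have hn : 0 < ‖Δ i‖ ^ 2 := pow_pos (norm_pos_iff.2 (hΦ.ne_zero (hΔ.mem i))) 2
  have : 0 < 2 * ⟪Δ i, Δ j⟫ / ‖Δ i‖ ^ 2 := by positivity
  linarith

/-- `s_i δ = δ - α_i`, hence `2 ⟪δ, α_i⟫ = ‖α_i‖²`. -/
lemma IsRootSystem.inner_delta_pos (hΦ : IsRootSystem Φ) (hΔ : IsSimpleSystem Φ Δ) (i : Fin n) :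
    0 < ⟪delta Φ Δ, Δ i⟫ := by
  classical
  set s := (ℝ ∙ (Δ i))ᗮ.reflection with hs
  have hfin : (positiveRoots Φ Δ).Finite := hΦ.finite.subset fun β h => h.1
  set P := hfin.toFinset with hP
  have hmem : ∀ β, β ∈ P ↔ β ∈ Φ ∧ ∀ j, 0 ≤ Δ.repr β j := fun β => by
    rw [hP, Set.Finite.mem_toFinset]
    rfl
  have hδ : delta Φ Δ = (1 / 2 : ℝ) • ∑ β ∈ P, β := by
    rw [delta, finsum_mem_eq_finite_toFinset_sum _ hfin]
  have hi : Δ i ∈ P := (hmem _).2 ⟨hΔ.mem i, fun k => by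
    rw [Basis.repr_self]
    exact Finsupp.single_nonneg.2 zero_le_one k⟩
  have hmaps : ∀ β ∈ P.erase (Δ i), s β ∈ P.erase (Δ i) := by
    intro β hβ
    rw [Finset.mem_erase, hmem] at hβ ⊢
    refine ⟨fun h => ?_, hΦ.reflection_mem _ (hΔ.mem i) β hβ.2.1,
      hΦ.reflection_nonneg hΔ hβ.2.1 hβ.2.2 hβ.1⟩
    have h1 : β = -Δ i := by
      rw [← reflection_self (Δ i), ← hs, ← h, hs, Submodule.reflection_reflection]
    have h2 := hβ.2.2 i
    rw [h1] at h2
    simp at h2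
    linarith
  have hsum : ∑ β ∈ P.erase (Δ i), s β = ∑ β ∈ P.erase (Δ i), β :=
    Finset.sum_nbij' s s hmaps hmaps (fun β _ => Submodule.reflection_reflection _ β)
      (fun β _ => Submodule.reflection_reflection _ β) fun β _ => rfl
  have h0 : ⟪∑ β ∈ P.erase (Δ i), β, Δ i⟫ = 0 := by
    have h1 : ⟪∑ β ∈ P.erase (Δ i), β, Δ i⟫ = ⟪s (∑ β ∈ P.erase (Δ i), β), s (Δ i)⟫ := by
      rw [LinearIsometryEquiv.inner_map_map]
    rw [map_sum, hsum, hs, reflection_self, inner_neg_right] at h1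
    linarith
  rw [hδ, ← Finset.add_sum_erase P _ hi, real_inner_smul_left, inner_add_left, h0, add_zero]
  have := real_inner_self_pos.2 (hΦ.ne_zero (hΔ.mem i))
  positivity

/-- Every element of the Coxeter group is a product of simple reflections. -/
lemma IsRootSystem.exists_wordProd_eq (hΦ : IsRootSystem Φ) (hΔ : IsSimpleSystem Φ Δ)
    {σ : V ≃ₗᵢ[ℝ] V} (hσ : σ ∈ weylGroup Φ) : ∃ l, wordProd Δ l = σ := by
  have hpos : ∀ β ∈ positiveRoots Φ Δ, ∃ l, wordProd Δ l = (ℝ ∙ β)ᗮ.reflection := by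
    by_contra! hbad
    -- a positive root of minimal height among those whose reflection is not such a product
    obtain ⟨β, ⟨⟨hβ, hβ0⟩, hβw⟩, hmin⟩ := Set.exists_min_image
      {β | β ∈ positiveRoots Φ Δ ∧ ∀ l, wordProd Δ l ≠ (ℝ ∙ β)ᗮ.reflection}
      (fun β => ∑ i, Δ.repr β i) (hΦ.finite.subset fun β h => h.1.1)
      (by obtain ⟨β, h1, h2⟩ := hbad; exact ⟨β, h1, h2⟩)
    obtain ⟨i, hi⟩ : ∃ i, 0 < ⟪β, Δ i⟫ := by
      by_contra! h
      have h1 := inner_eq_sum_of_mem_simpleSpan (Δ := Δ) (I := Finset.univ) (w := β)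
        (by simp [simpleSpan_univ]) β
      have h2 := real_inner_self_pos.2 (hΦ.ne_zero hβ)
      rw [h1] at h2
      exact absurd h2 (not_lt.2 (Finset.sum_nonpos fun i _ =>
        mul_nonpos_of_nonneg_of_nonpos (hβ0 i) (h i)))
    have hne : β ≠ Δ i := by
      rintro rfl
      exact hβw [i] (wordProd_singleton i)
    set s := (ℝ ∙ (Δ i))ᗮ.reflection with hs
    have hsβ : s β ∈ positiveRoots Φ Δ :=
      ⟨hΦ.reflection_mem _ (hΔ.mem i) β hβ, hΦ.reflection_nonneg hΔ hβ hβ0 hne⟩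
    have hheight : ∑ j, Δ.repr (s β) j < ∑ j, Δ.repr β j := by
      have hn : 0 < ‖Δ i‖ ^ 2 := pow_pos (norm_pos_iff.2 (hΦ.ne_zero (hΔ.mem i))) 2
      refine Finset.sum_lt_sum (fun j _ => ?_) ⟨i, Finset.mem_univ i, ?_⟩
      · by_cases hj : j = i
        · rw [hs, reflection_apply_eq, map_sub, map_smul, Basis.repr_self, real_inner_comm]
          simp [hj]
          positivity
        · rw [hs, repr_reflection i j β hj]
      · rw [hs, reflection_apply_eq, map_sub, map_smul, Basis.repr_self, real_inner_comm]
        simp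
        positivity
    obtain ⟨l, hl⟩ : ∃ l, wordProd Δ l = (ℝ ∙ (s β))ᗮ.reflection := by
      by_contra! h
      exact absurd (hmin (s β) ⟨hsβ, h⟩) (not_le.2 hheight)
    refine hβw ([i] ++ l ++ [i]) ?_
    rw [wordProd_append, wordProd_append, wordProd_singleton, hl, ← hs, mul_assoc,
      ← mul_reflection s β, ← mul_assoc, Submodule.reflection_mul_reflection, one_mul]
  refine Subgroup.closure_induction ?_ ?_ ?_ ?_ hσ
  · rintro _ ⟨α, hα, rfl⟩
    rcases hΔ.nonneg_or_nonpos α hα with h | h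
    · exact hpos α ⟨hα, h⟩
    · have hneg : -α ∈ Φ := by
        rw [← reflection_self α]
        exact hΦ.reflection_mem α hα α hα
      obtain ⟨l, hl⟩ := hpos (-α) ⟨hneg, fun i => by simpa using h i⟩
      refine ⟨l, hl.trans ?_⟩
      ext v
      simp [reflection_apply_eq, neg_div, sub_eq_add_neg]
  · exact ⟨[], wordProd_nil⟩
  · rintro _ _ _ _ ⟨l, rfl⟩ ⟨l', rfl⟩
    exact ⟨l ++ l', wordProd_append l l'⟩
  · rintro _ _ ⟨l, rfl⟩
    exact ⟨l.reverse, (wordProd_inv l).symm⟩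

/-- The exchange condition. -/
lemma IsRootSystem.exists_wordProd_mul_eq (hΦ : IsRootSystem Φ) (hΔ : IsSimpleSystem Φ Δ)
    (i : Fin n) (l : List (Fin n)) (h : ∀ j, Δ.repr (wordProd Δ l (Δ i)) j ≤ 0) :
    ∃ l', l'.length + 1 = l.length ∧
      wordProd Δ l * (ℝ ∙ (Δ i))ᗮ.reflection = wordProd Δ l' := by
  induction l with
  | nil =>
    have := h i
    simp [wordProd_nil] at this
    linarith
  | cons k t ih =>
    have hroot : wordProd Δ t (Δ i) ∈ Φ :=
      hΦ.weylGroup_apply_mem (wordProd_mem hΔ t) (hΔ.mem i)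
    rcases hΔ.nonneg_or_nonpos _ hroot with hp | hn
    · have hk : wordProd Δ t (Δ i) = Δ k := by
        by_contra hne
        have h1 := hΦ.reflection_nonneg hΔ hroot hp hne
        rw [wordProd_cons] at h
        exact hΦ.ne_zero (hΦ.reflection_mem _ (hΔ.mem k) _ hroot)
          (eq_zero_of_nonneg_of_nonpos h1 h)
      refine ⟨t, by simp, ?_⟩
      rw [wordProd_cons, mul_assoc, mul_reflection, hk, ← mul_assoc,
        Submodule.reflection_mul_reflection, one_mul]
    · obtain ⟨t', ht', hprod⟩ := ih hn
      exact ⟨k :: t', by simp [ht'], by rw [wordProd_cons, wordProd_cons, mul_assoc, hprod]⟩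

lemma inner_nonneg_of_repr_nonneg {y w : V} (hy : ∀ i, 0 ≤ ⟪y, Δ i⟫)
    (hw : ∀ i, 0 ≤ Δ.repr w i) : 0 ≤ ⟪y, w⟫ := by
  rw [inner_eq_sum_of_mem_simpleSpan (Δ := Δ) (I := Finset.univ) (w := w)
    (by simp [simpleSpan_univ])]
  exact Finset.sum_nonneg fun i _ => mul_nonneg (hw i) (hy i)

/-- Among the vectors of the orbit of a dominant vector, it is the dominant one that has the largest
inner product with a given dominant vector. The proof shortens a word for `σ`. -/
lemma IsRootSystem.inner_apply_le (hΦ : IsRootSystem Φ) (hΔ : IsSimpleSystem Φ Δ)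
    {σ : V ≃ₗᵢ[ℝ] V} (hσ : σ ∈ weylGroup Φ) {x y : V} (hx : ∀ i, 0 ≤ ⟪x, Δ i⟫)
    (hy : ∀ i, 0 ≤ ⟪y, Δ i⟫) : ⟪σ x, y⟫ ≤ ⟪x, y⟫ := by
  have key : ∀ m, ∀ l : List (Fin n), l.length = m → ⟪wordProd Δ l x, y⟫ ≤ ⟪x, y⟫ := by
    intro m
    induction m using Nat.strong_induction_on with
    | _ m ih =>
    intro l hl
    by_cases hneg : ∃ i, ∀ j, Δ.repr (wordProd Δ l (Δ i)) j ≤ 0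
    · obtain ⟨i, hi⟩ := hneg
      obtain ⟨l', hl', hprod⟩ := hΦ.exists_wordProd_mul_eq hΔ i l hi
      refine le_trans ?_ (ih l'.length (by omega) l' rfl)
      have hmove : wordProd Δ l' x = wordProd Δ l x -
          (2 * ⟪Δ i, x⟫ / ‖Δ i‖ ^ 2) • wordProd Δ l (Δ i) := by
        rw [← hprod, LinearIsometryEquiv.coe_mul, Function.comp_apply, reflection_apply_eq,
          map_sub, map_smul]
      rw [hmove, inner_sub_left, real_inner_smul_left]
      have h1 : ⟪wordProd Δ l (Δ i), y⟫ ≤ 0 := by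
        have := inner_nonneg_of_repr_nonneg (w := -wordProd Δ l (Δ i)) hy
          (fun j => by simpa using hi j)
        rw [inner_neg_right, real_inner_comm] at this
        linarith
      have h2 : 0 ≤ 2 * ⟪Δ i, x⟫ / ‖Δ i‖ ^ 2 := by
        have := hx i
        rw [real_inner_comm] at this
        positivity
      have := mul_nonpos_of_nonneg_of_nonpos h2 h1
      linarith
    · push Not at hneg
      rcases List.eq_nil_or_concat l with rfl | ⟨t, k, rfl⟩
      · rfl
      · rw [List.concat_eq_append] at *
        have htk : wordProd Δ t (Δ k) = -wordProd Δ (t ++ [k]) (Δ k) := by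
          rw [wordProd_append, wordProd_singleton, LinearIsometryEquiv.coe_mul,
            Function.comp_apply, reflection_self, map_neg, neg_neg]
        have hroot : wordProd Δ (t ++ [k]) (Δ k) ∈ Φ :=
          hΦ.weylGroup_apply_mem (wordProd_mem hΔ _) (hΔ.mem k)
        have hpos : ∀ j, 0 ≤ Δ.repr (wordProd Δ (t ++ [k]) (Δ k)) j :=
          (hΔ.nonneg_or_nonpos _ hroot).resolve_right fun h => by
            obtain ⟨j, hj⟩ := hneg k
            exact absurd (h j) (not_le.2 hj)
        obtain ⟨l', hl', hprod⟩ := hΦ.exists_wordProd_mul_eq hΔ k t fun j => by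
          rw [htk]
          simpa using hpos j
        rw [wordProd_append, wordProd_singleton, hprod]
        rw [List.length_append, List.length_singleton] at hl
        exact ih l'.length (by omega) l' rfl
  obtain ⟨l, rfl⟩ := hΦ.exists_wordProd_eq hΔ hσ
  exact key _ l rfl

lemma IsRootSystem.finite_weylGroup (hΦ : IsRootSystem Φ) :
    (weylGroup Φ : Set (V ≃ₗᵢ[ℝ] V)).Finite := by
  have : Finite Φ := hΦ.finite
  let f : weylGroup Φ → (Φ → Φ) := fun σ β => ⟨σ.1 β, hΦ.weylGroup_apply_mem σ.2 β.2⟩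
  have hf : Function.Injective f := by
    intro σ τ h
    have h1 : Set.EqOn (σ.1.toLinearEquiv : V →ₗ[ℝ] V) (τ.1.toLinearEquiv : V →ₗ[ℝ] V) Φ :=
      fun β hβ => congrArg Subtype.val (congrFun h ⟨β, hβ⟩)
    have h2 := LinearMap.ext_on hΦ.span_eq_top h1
    ext x
    exact LinearMap.congr_fun h2 x
  have : Finite (weylGroup Φ) := Finite.of_injective f hf
  exact Set.toFinite _

/-- Every vector is conjugate to a vector of the closed fundamental chamber. -/
lemma IsRootSystem.exists_dominant (hΦ : IsRootSystem Φ) (hΔ : IsSimpleSystem Φ Δ) (y : V) :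
    ∃ σ ∈ weylGroup Φ, ∀ i, 0 ≤ ⟪σ y, Δ i⟫ := by
  obtain ⟨σ, hσ, hmax⟩ := Set.exists_max_image (weylGroup Φ : Set (V ≃ₗᵢ[ℝ] V))
    (fun σ => ⟪σ y, delta Φ Δ⟫) hΦ.finite_weylGroup ⟨1, Subgroup.one_mem _⟩
  refine ⟨σ, hσ, fun i => ?_⟩
  by_contra! hneg
  have h := hmax ((ℝ ∙ (Δ i))ᗮ.reflection * σ)
    (Subgroup.mul_mem _ (reflection_basis_mem hΔ i) hσ)
  rw [LinearIsometryEquiv.coe_mul, Function.comp_apply, inner_reflection] at h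
  have hn : 0 < ‖Δ i‖ ^ 2 := pow_pos (norm_pos_iff.2 (hΦ.ne_zero (hΔ.mem i))) 2
  have hd := hΦ.inner_delta_pos hΔ i
  rw [real_inner_comm] at hneg hd
  have h1 : 2 * ⟪Δ i, σ y⟫ / ‖Δ i‖ ^ 2 < 0 := div_neg_of_neg_of_pos (by linarith) hn
  have := mul_neg_of_neg_of_pos h1 hd
  linarith

end Weyl

/-! ### The building set of the simple roots -/

section Building

variable {V : Type*} [NormedAddCommGroup V] [InnerProductSpace ℝ V]
  {n : ℕ} {Φ : Set V} {Δ : Basis (Fin n) ℝ V} {G : Set (Submodule ℝ V)}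

/-- The sets of indices of simple roots whose span belongs to `G`. -/
def indexBuilding (Δ : Basis (Fin n) ℝ V) (G : Set (Submodule ℝ V)) : Set (Finset (Fin n)) :=
  {I | simpleSpan Δ I ∈ G}

lemma mem_indexBuilding {I : Finset (Fin n)} : I ∈ indexBuilding Δ G ↔ simpleSpan Δ I ∈ G :=
  Iff.rfl

lemma mem_fund_iff {A : Submodule ℝ V} :
    A ∈ fund Δ G ↔ ∃ I ∈ indexBuilding Δ G, simpleSpan Δ I = A := by
  constructor
  · rintro ⟨hA, I, rfl⟩
    have h : simpleSpan Δ I.toFinite.toFinset = Submodule.span ℝ (Δ '' I) := by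
      simp [simpleSpan]
    exact ⟨I.toFinite.toFinset, by rwa [mem_indexBuilding, h], h⟩
  · rintro ⟨I, hI, rfl⟩
    exact ⟨hI, I, rfl⟩

lemma simpleSpan_mem_fund_iff {I : Finset (Fin n)} :
    simpleSpan Δ I ∈ fund Δ G ↔ I ∈ indexBuilding Δ G :=
  ⟨fun h => h.1, fun h => mem_fund_iff.2 ⟨I, h, rfl⟩⟩

lemma fund_eq_image : fund Δ G = simpleSpan Δ '' indexBuilding Δ G :=
  Set.ext fun _ => mem_fund_iff

lemma finite_fund : (fund Δ G).Finite := by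
  rw [fund_eq_image]
  exact (Set.toFinite _).image _

lemma simpleSpan_mem_spannedSubspaces (hΔ : IsSimpleSystem Φ Δ) {I : Finset (Fin n)}
    (hI : I.Nonempty) : simpleSpan Δ I ∈ spannedSubspaces Φ := by
  refine ⟨Δ '' I, (Finset.coe_nonempty.2 hI).image _, ?_, rfl⟩
  rintro _ ⟨i, -, rfl⟩
  exact hΔ.mem i

lemma mem_decomposition {A C : Submodule ℝ V} :
    A ∈ decomposition G C ↔ Maximal (fun D => D ∈ G ∧ D ≤ C) A :=
  Iff.rfl

lemma decomposition_fund (J : Finset (Fin n)) : decomposition (fund Δ G) (simpleSpan Δ J) =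
    simpleSpan Δ '' (indexDecomposition (indexBuilding Δ G) J : Set (Finset (Fin n))) := by
  ext A
  simp only [mem_decomposition, Set.mem_image, Finset.mem_coe, mem_indexDecomposition]
  constructor
  · intro hA
    obtain ⟨I, hI, rfl⟩ := mem_fund_iff.1 hA.prop.1
    refine ⟨I, ⟨⟨hI, simpleSpan_le_simpleSpan.1 hA.prop.2⟩, fun K hK hIK => ?_⟩, rfl⟩
    exact simpleSpan_le_simpleSpan.1 (hA.le_of_ge
      ⟨simpleSpan_mem_fund_iff.2 hK.1, simpleSpan_le_simpleSpan.2 hK.2⟩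
      (simpleSpan_le_simpleSpan.2 hIK))
  · rintro ⟨I, hI, rfl⟩
    refine ⟨⟨simpleSpan_mem_fund_iff.2 hI.prop.1, simpleSpan_le_simpleSpan.2 hI.prop.2⟩, ?_⟩
    rintro D ⟨hD, hDJ⟩ hID
    obtain ⟨K, hK, rfl⟩ := mem_fund_iff.1 hD
    exact simpleSpan_le_simpleSpan.2 (hI.le_of_ge ⟨hK, simpleSpan_le_simpleSpan.1 hDJ⟩
      (simpleSpan_le_simpleSpan.1 hID))

lemma finsum_decomposition_fund {M : Type*} [AddCommMonoid M] (f : Submodule ℝ V → M)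
    (J : Finset (Fin n)) : ∑ᶠ A ∈ decomposition (fund Δ G) (simpleSpan Δ J), f A =
      ∑ I ∈ indexDecomposition (indexBuilding Δ G) J, f (simpleSpan Δ I) := by
  rw [decomposition_fund, finsum_mem_image simpleSpan_injective.injOn, finsum_mem_coe_finset]

/-- If two members of a building set contain roots which are not orthogonal to each other, then
their sum belongs to the building set: two different blocks of the decomposition of the sum cannot
contain these roots, as the reflection of one root in the other would lie in no block. -/
lemma IsBuildingSet.sup_mem [FiniteDimensional ℝ V] (hΦ : IsRootSystem Φ) (hG : IsBuildingSet Φ G)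
    {A C : Submodule ℝ V} (hA : A ∈ G) (hC : C ∈ G) {α β : V} (hα : α ∈ Φ) (hαA : α ∈ A)
    (hβ : β ∈ Φ) (hβC : β ∈ C) (h : ⟪α, β⟫ ≠ 0) : A ⊔ C ∈ G := by
  have hspan : A ⊔ C ∈ spannedSubspaces Φ := by
    obtain ⟨T, hT, hTΦ, rfl⟩ := hG.subset hA
    obtain ⟨U, hU, hUΦ, rfl⟩ := hG.subset hC
    exact ⟨T ∪ U, hT.inl, Set.union_subset hTΦ hUΦ, (Submodule.span_union T U).symm⟩
  have hex : ∀ D ∈ G, D ≤ A ⊔ C → ∃ M ∈ decomposition G (A ⊔ C), D ≤ M := by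
    intro D hD hDle
    obtain ⟨M, ⟨hM, hDM⟩, hmax⟩ := WellFounded.has_min
      (wellFounded_gt (α := Submodule ℝ V)) {M | (M ∈ G ∧ M ≤ A ⊔ C) ∧ D ≤ M}
      ⟨D, ⟨hD, hDle⟩, le_rfl⟩
    refine ⟨M, ⟨hM, fun N hN hMN => ?_⟩, hDM⟩
    by_contra hne
    exact hmax N ⟨hN, hDM.trans hMN⟩ (lt_of_le_not_ge hMN hne)
  obtain ⟨M, hM, hAM⟩ := hex A hA le_sup_left
  obtain ⟨N, hN, hCN⟩ := hex C hC le_sup_right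
  rw [mem_decomposition] at hM hN
  have hind := hG.sSupIndep_decomposition _ hspan
  have hdisj : ∀ {X Y : Submodule ℝ V}, X ∈ decomposition G (A ⊔ C) →
      Y ∈ decomposition G (A ⊔ C) → X ≠ Y → ∀ v ∈ X, v ∈ Y → v = 0 := by
    intro X Y hX hY hne v hvX hvY
    exact Submodule.disjoint_def.1 (hind.pairwiseDisjoint hX hY hne) v hvX hvY
  by_cases hMN : M = N
  · subst hMN
    have : A ⊔ C = M := le_antisymm (sup_le hAM hCN) hM.prop.2
    rw [this]
    exact hM.prop.1
  exfalso
  set γ := (ℝ ∙ α)ᗮ.reflection β with hγ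
  have hγΦ : γ ∈ Φ := hΦ.reflection_mem α hα β hβ
  set t := 2 * ⟪α, β⟫ / ‖α‖ ^ 2 with ht
  have hγ_eq : γ = β - t • α := reflection_apply_eq α β
  have ht0 : t ≠ 0 := by
    have : ‖α‖ ≠ 0 := norm_ne_zero_iff.2 (hΦ.ne_zero hα)
    rw [ht]
    positivity
  have hγAC : γ ∈ A ⊔ C := by
    rw [hγ_eq]
    exact Submodule.sub_mem _ (le_sup_right (a := A) hβC)
      (Submodule.smul_mem _ _ (le_sup_left (b := C) hαA))
  obtain ⟨K, hK, hγK'⟩ := hex (ℝ ∙ γ) (hG.line_mem γ hγΦ)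
    ((Submodule.span_singleton_le_iff_mem _ _).2 hγAC)
  have hγK : γ ∈ K := hγK' (Submodule.mem_span_singleton_self γ)
  by_cases hKM : K = M
  · subst hKM
    have hβK : β ∈ K := by
      have : β = γ + t • α := by rw [hγ_eq]; abel
      rw [this]
      exact Submodule.add_mem _ hγK (Submodule.smul_mem _ _ (hAM hαA))
    exact hΦ.ne_zero hβ (hdisj hM hN hMN β hβK (hCN hβC))
  by_cases hKN : K = N
  · subst hKN
    have hαK : α ∈ K := by
      have h1 : t • α = β - γ := by rw [hγ_eq]; abel
      have h2 : t • α ∈ K := by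
        rw [h1]
        exact Submodule.sub_mem _ (hCN hβC) hγK
      exact (Submodule.smul_mem_iff _ ht0).1 h2
    exact hΦ.ne_zero hα (hdisj hM hN hMN α (hAM hαA) hαK)
  · have h1 := hind hK
    refine hΦ.ne_zero hγΦ (Submodule.disjoint_def.1 h1 γ hγK ?_)
    rw [hγ_eq]
    exact Submodule.sub_mem _
      ((le_sSup (a := N) (Set.mem_sdiff_singleton.2 ⟨hN, Ne.symm hKN⟩)) (hCN hβC))
      (Submodule.smul_mem _ _ ((le_sSup (a := M) (Set.mem_sdiff_singleton.2 ⟨hM, Ne.symm hKM⟩))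
        (hAM hαA)))

variable [FiniteDimensional ℝ V]

lemma IsBuildingSet.union_mem (hΦ : IsRootSystem Φ) (hΔ : IsSimpleSystem Φ Δ)
    (hG : IsBuildingSet Φ G) {I J : Finset (Fin n)} (hI : I ∈ indexBuilding Δ G)
    (hJ : J ∈ indexBuilding Δ G) {i j : Fin n} (hi : i ∈ I) (hj : j ∈ J)
    (h : ⟪Δ i, Δ j⟫ ≠ 0) : I ∪ J ∈ indexBuilding Δ G := by
  have h1 := hG.sup_mem hΦ hI hJ (hΔ.mem i) (basis_mem_simpleSpan.2 hi) (hΔ.mem j)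
    (basis_mem_simpleSpan.2 hj) h
  rw [mem_indexBuilding]
  convert h1 using 1
  simp [simpleSpan, Set.image_union, Submodule.span_union]

lemma IsBuildingSet.isIndexBuilding (hΦ : IsRootSystem Φ) (hΔ : IsSimpleSystem Φ Δ)
    (hG : IsBuildingSet Φ G) (hGV : ⊤ ∈ G) : IsIndexBuilding (indexBuilding Δ G) where
  nonempty I hI := by
    rw [Finset.nonempty_iff_ne_empty]
    rintro rfl
    obtain ⟨T, ⟨t, ht⟩, hTΦ, h⟩ := hG.subset hI
    rw [simpleSpan_empty] at h
    have : t ∈ (⊥ : Submodule ℝ V) := h ▸ Submodule.subset_span ht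
    exact hΦ.ne_zero (hTΦ ht) ((Submodule.mem_bot ℝ).1 this)
  singleton_mem i := by
    rw [mem_indexBuilding]
    simpa [simpleSpan] using hG.line_mem (Δ i) (hΔ.mem i)
  union_mem I hI J hJ := by
    rintro ⟨i, hi⟩
    rw [Finset.mem_inter] at hi
    exact hG.union_mem hΦ hΔ hI hJ hi.1 hi.2
      (inner_self_ne_zero.2 (hΦ.ne_zero (hΔ.mem i)))
  univ_mem := by rwa [mem_indexBuilding, simpleSpan_univ]

lemma inner_eq_zero_of_mem_indexDecomposition (hΦ : IsRootSystem Φ) (hΔ : IsSimpleSystem Φ Δ)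
    (hG : IsBuildingSet Φ G) {J A C : Finset (Fin n)}
    (hA : A ∈ indexDecomposition (indexBuilding Δ G) J)
    (hC : C ∈ indexDecomposition (indexBuilding Δ G) J) (hne : A ≠ C) {i j : Fin n} (hi : i ∈ A)
    (hj : j ∈ C) : ⟪Δ i, Δ j⟫ = 0 := by
  rw [mem_indexDecomposition] at hA hC
  by_contra h
  have hU := hG.union_mem hΦ hΔ hA.prop.1 hC.prop.1 hi hj h
  have hUJ : A ∪ C ≤ J := Finset.union_subset hA.prop.2 hC.prop.2
  exact hne ((hA.eq_of_le ⟨hU, hUJ⟩ Finset.subset_union_left).trans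
    (hC.eq_of_le ⟨hU, hUJ⟩ Finset.subset_union_right).symm)

lemma sup_indexDecomposition {B : Set (Finset (Fin n))} (hB : IsIndexBuilding B)
    (J : Finset (Fin n)) : (indexDecomposition B J).sup id = J := by
  apply le_antisymm
  · exact Finset.sup_le fun C hC => (mem_indexDecomposition.1 hC).prop.2
  · intro i hi
    obtain ⟨D, hD, hiD⟩ := exists_mem_indexDecomposition (hB.singleton_mem i)
      (Finset.singleton_subset_iff.2 hi)
    exact Finset.mem_sup.2 ⟨D, hD, Finset.singleton_subset_iff.1 hiD⟩

lemma indexDecomposition_of_mem {B : Set (Finset (Fin n))} {I : Finset (Fin n)} (hI : I ∈ B) :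
    indexDecomposition B I = {I} := by
  ext C
  rw [mem_indexDecomposition, Finset.mem_singleton]
  constructor
  · intro h
    exact h.eq_of_le ⟨hI, le_rfl⟩ h.prop.2
  · rintro rfl
    exact ⟨⟨hI, le_rfl⟩, fun D hD _ => hD.2⟩

lemma indexDecomposition_empty {B : Set (Finset (Fin n))} (hB : IsIndexBuilding B) :
    indexDecomposition B ∅ = ∅ := by
  rw [Finset.eq_empty_iff_forall_notMem]
  intro C hC
  rw [mem_indexDecomposition] at hC
  obtain ⟨i, hi⟩ := hB.nonempty C hC.prop.1
  exact Finset.notMem_empty i (hC.prop.2 hi)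

/-- The blocks of the decomposition of a span of simple roots are pairwise orthogonal. -/
lemma piVec_eq_sum_indexDecomposition (hΦ : IsRootSystem Φ) (hΔ : IsSimpleSystem Φ Δ)
    (hG : IsBuildingSet Φ G) (hGV : ⊤ ∈ G) (J : Finset (Fin n)) :
    piVec Φ Δ (simpleSpan Δ J) =
      ∑ I ∈ indexDecomposition (indexBuilding Δ G) J, piVec Φ Δ (simpleSpan Δ I) := by
  have h := starProjection_simpleSpan_sup (Δ := Δ)
    (T := indexDecomposition (indexBuilding Δ G) J)
    (fun A hA C hC hne i hi j hj =>
      inner_eq_zero_of_mem_indexDecomposition hΦ hΔ hG hA hC hne hi hj) (delta Φ Δ)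
  rwa [sup_indexDecomposition (hG.isIndexBuilding hΦ hΔ hGV)] at h

/-! ### Growth of the suitable lists -/

variable (Φ Δ) in
/-- The coefficients of `π_I`, for a set `I` of indices of simple roots. -/
noncomputable def piCoeff (I : Finset (Fin n)) (i : Fin n) : ℝ :=
  Δ.repr (piVec Φ Δ (simpleSpan Δ I)) i

lemma piCoeff_pos (hΦ : IsRootSystem Φ) (hΔ : IsSimpleSystem Φ Δ) {I : Finset (Fin n)} {i : Fin n}
    (hi : i ∈ I) : 0 < piCoeff Φ Δ I i :=
  (hΦ.isObtuse hΔ).repr_starProjection_pos (hΦ.inner_delta_pos hΔ) hi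

lemma piCoeff_mono (hΦ : IsRootSystem Φ) (hΔ : IsSimpleSystem Φ Δ) {I J : Finset (Fin n)}
    (hIJ : I ⊆ J) (i : Fin n) : piCoeff Φ Δ I i ≤ piCoeff Φ Δ J i :=
  (hΦ.isObtuse hΔ).repr_starProjection_mono (hΦ.inner_delta_pos hΔ) hIJ i

lemma piCoeff_le_maxCoeff {I : Finset (Fin n)} {i : Fin n} (hi : i ∈ I) :
    piCoeff Φ Δ I i ≤ maxCoeff Φ Δ (simpleSpan Δ I) :=
  le_ciSup (f := fun i : {i : Fin n // Δ i ∈ simpleSpan Δ I} =>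
    Δ.repr (piVec Φ Δ (simpleSpan Δ I)) i) (Set.finite_range _).bddAbove
    ⟨i, basis_mem_simpleSpan.2 hi⟩

lemma minCoeff_le_piCoeff {I : Finset (Fin n)} {i : Fin n} (hi : i ∈ I) :
    minCoeff Φ Δ (simpleSpan Δ I) ≤ piCoeff Φ Δ I i :=
  ciInf_le (f := fun i : {i : Fin n // Δ i ∈ simpleSpan Δ I} =>
    Δ.repr (piVec Φ Δ (simpleSpan Δ I)) i) (Set.finite_range _).bddBelow
    ⟨i, basis_mem_simpleSpan.2 hi⟩

lemma minCoeff_pos (hΦ : IsRootSystem Φ) (hΔ : IsSimpleSystem Φ Δ) {I : Finset (Fin n)}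
    (hI : I.Nonempty) : 0 < minCoeff Φ Δ (simpleSpan Δ I) := by
  obtain ⟨i, hi⟩ := hI
  have : Nonempty {i : Fin n // Δ i ∈ simpleSpan Δ I} := ⟨⟨i, basis_mem_simpleSpan.2 hi⟩⟩
  obtain ⟨k, hk⟩ := exists_eq_ciInf_of_finite (f := fun i : {i : Fin n // Δ i ∈ simpleSpan Δ I} =>
    Δ.repr (piVec Φ Δ (simpleSpan Δ I)) i)
  rw [minCoeff, ← hk]
  exact piCoeff_pos hΦ hΔ (basis_mem_simpleSpan.1 k.2)

lemma ratios_bddAbove (i j : ℕ) : BddAbove (ratios Φ Δ G i j) := by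
  refine ((finite_fund (Δ := Δ) (G := G)).image2
    (fun A C => maxCoeff Φ Δ A / minCoeff Φ Δ C) (finite_fund (Δ := Δ) (G := G))).bddAbove.mono ?_
  rintro r ⟨A, hA, C, hC, -, -, -, rfl⟩
  exact ⟨A, hA, C, hC, rfl⟩

lemma le_maxRatio {i j : ℕ} {r : ℝ} (hr : r ∈ ratios Φ Δ G i j) : r ≤ maxRatio Φ Δ G i j := by
  rw [maxRatio, if_pos ⟨r, hr⟩]
  exact le_csSup (ratios_bddAbove i j) hr

lemma one_le_maxRatio (hΦ : IsRootSystem Φ) (hΔ : IsSimpleSystem Φ Δ) (hG : IsBuildingSet Φ G)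
    (hGV : ⊤ ∈ G) (i j : ℕ) : 1 ≤ maxRatio Φ Δ G i j := by
  by_cases h : (ratios Φ Δ G i j).Nonempty
  swap
  · rw [maxRatio, if_neg h]
  obtain ⟨r, hr⟩ := h
  refine le_trans ?_ (le_maxRatio hr)
  obtain ⟨A, hA, C, hC, hCA, -, -, rfl⟩ := hr
  obtain ⟨I, hI, rfl⟩ := mem_fund_iff.1 hA
  obtain ⟨J, hJ, rfl⟩ := mem_fund_iff.1 hC
  rw [simpleSpan_le_simpleSpan] at hCA
  have hJne := (hG.isIndexBuilding hΦ hΔ hGV).nonempty J hJ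
  rw [one_le_div (minCoeff_pos hΦ hΔ hJne)]
  obtain ⟨k, hk⟩ := hJne
  exact (minCoeff_le_piCoeff hk).trans ((piCoeff_mono hΦ hΔ hCA k).trans
    (piCoeff_le_maxCoeff (hCA hk)))

variable {ε : ℕ → ℝ}

lemma IsSuitable.card_pos (hε : IsSuitable Φ Δ G ε) {I : Finset (Fin n)} (hI : I.Nonempty) :
    0 < ε I.card :=
  hε.pos _ ⟨hI.card_pos, by simpa using I.card_le_univ⟩

lemma IsSuitable.two_pow_mul_le (hε : IsSuitable Φ Δ G ε) (hΦ : IsRootSystem Φ)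
    (hΔ : IsSimpleSystem Φ Δ) (hG : IsBuildingSet Φ G) (hGV : ⊤ ∈ G) {k m : ℕ} (hk : 1 ≤ k)
    (hkm : k ≤ m) (hm : m ≤ n) : 2 ^ m * ε k ≤ 2 ^ k * ε m := by
  induction m, hkm using Nat.le_induction with
  | base => exact le_rfl
  | succ m hkm ih =>
    have h1 := hε.lt (m + 1) ⟨by omega, hm⟩
    have h2 := one_le_maxRatio hΦ hΔ hG hGV (m + 1) m
    have h3 := hε.pos m ⟨by omega, by omega⟩
    rw [Nat.add_sub_cancel] at h1
    have h4 : 2 * ε m ≤ ε (m + 1) := by nlinarith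
    have h5 := ih (by omega)
    calc (2 : ℝ) ^ (m + 1) * ε k = 2 * (2 ^ m * ε k) := by rw [pow_succ]; ring
      _ ≤ 2 * (2 ^ k * ε m) := by linarith
      _ = 2 ^ k * (2 * ε m) := by ring
      _ ≤ 2 ^ k * ε (m + 1) := by gcongr

lemma IsSuitable.two_mul_le_of_card_eq (hε : IsSuitable Φ Δ G ε) (hΦ : IsRootSystem Φ)
    (hΔ : IsSimpleSystem Φ Δ) {I J : Finset (Fin n)} (hI : I ∈ indexBuilding Δ G)
    (hJ : J ∈ indexBuilding Δ G) (hIJ : I ⊆ J) (hcard : J.card = I.card + 1) {i : Fin n}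
    (hi : i ∈ I) :
    2 * ε I.card * piCoeff Φ Δ J i ≤ ε J.card * piCoeff Φ Δ I i := by
  have hne : I.Nonempty := ⟨i, hi⟩
  have hmin := minCoeff_pos hΦ hΔ hne
  have hr : maxCoeff Φ Δ (simpleSpan Δ J) / minCoeff Φ Δ (simpleSpan Δ I) ≤
      maxRatio Φ Δ G J.card (J.card - 1) :=
    le_maxRatio ⟨_, simpleSpan_mem_fund_iff.2 hJ, _, simpleSpan_mem_fund_iff.2 hI,
      simpleSpan_le_simpleSpan.2 hIJ, finrank_simpleSpan J,
      by rw [finrank_simpleSpan, hcard, Nat.add_sub_cancel], rfl⟩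
  have hlt := hε.lt J.card ⟨by have := hne.card_pos; omega, by simpa using J.card_le_univ⟩
  rw [div_le_iff₀ hmin] at hr
  rw [hcard, Nat.add_sub_cancel] at hlt hr
  rw [hcard]
  set R := maxRatio Φ Δ G (I.card + 1) I.card
  have hε0 := hε.card_pos hne
  have h1 : piCoeff Φ Δ J i ≤ R * minCoeff Φ Δ (simpleSpan Δ I) :=
    (piCoeff_le_maxCoeff (hIJ hi)).trans hr
  calc 2 * ε I.card * piCoeff Φ Δ J i
      ≤ 2 * ε I.card * (R * minCoeff Φ Δ (simpleSpan Δ I)) := by gcongr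
    _ = (2 * R * ε I.card) * minCoeff Φ Δ (simpleSpan Δ I) := by ring
    _ ≤ ε (I.card + 1) * minCoeff Φ Δ (simpleSpan Δ I) := by gcongr
    _ ≤ ε (I.card + 1) * piCoeff Φ Δ I i :=
        mul_le_mul_of_nonneg_left (minCoeff_le_piCoeff hi)
          (hcard ▸ hε.card_pos (hne.mono hIJ)).le

/-- The growth condition on consecutive dimensions implies the one for all pairs `I ⊆ J`: as long as
some simple root of `J` is not orthogonal to `I`, it can be added to `I` within the building set; when
there is none left, the coefficients of `π_J` and `π_I` agree on `I`. -/
lemma IsSuitable.key (hε : IsSuitable Φ Δ G ε) (hΦ : IsRootSystem Φ)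
    (hΔ : IsSimpleSystem Φ Δ) (hG : IsBuildingSet Φ G) (hGV : ⊤ ∈ G) {J : Finset (Fin n)} (m : ℕ) :
    ∀ I ∈ indexBuilding Δ G, I ⊆ J → J.card = I.card + m → ∀ i ∈ I,
      2 ^ J.card * ε I.card * piCoeff Φ Δ J i ≤ 2 ^ I.card * ε J.card * piCoeff Φ Δ I i := by
  have hB := hG.isIndexBuilding hΦ hΔ hGV
  induction m with
  | zero =>
    intro I _ hIJ hcard i _
    rw [Finset.eq_of_subset_of_card_le hIJ (by omega)]
  | succ m ih =>
    intro I hI hIJ hcard i hi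
    by_cases hadj : ∃ k ∈ I, ∃ j ∈ J, j ∉ I ∧ ⟪Δ k, Δ j⟫ ≠ 0
    · obtain ⟨k, hk, j, hj, hjI, hkj⟩ := hadj
      have hI' : insert j I ∈ indexBuilding Δ G := by
        have := hG.union_mem hΦ hΔ hI (hB.singleton_mem j) hk (Finset.mem_singleton_self j) hkj
        rwa [Finset.union_comm, ← Finset.insert_eq] at this
      have hIc : (insert j I).card = I.card + 1 := Finset.card_insert_of_notMem hjI
      have h1 := ih (insert j I) hI' (Finset.insert_subset hj hIJ) (by omega) i
        (Finset.mem_insert_of_mem hi)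
      have h2 := hε.two_mul_le_of_card_eq hΦ hΔ hI hI' (Finset.subset_insert _ _) hIc hi
      rw [hIc] at h1 h2
      have hpos : 0 < ε (I.card + 1) := hIc ▸ hε.card_pos (Finset.insert_nonempty j I)
      have hI0 : 0 < ε I.card := hε.card_pos ⟨i, hi⟩
      have hJ0 : 0 < ε J.card := hε.card_pos ⟨j, hj⟩
      refine le_of_mul_le_mul_right ?_ hpos
      calc 2 ^ J.card * ε I.card * piCoeff Φ Δ J i * ε (I.card + 1)
          = ε I.card * (2 ^ J.card * ε (I.card + 1) * piCoeff Φ Δ J i) := by ring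
        _ ≤ ε I.card * (2 ^ (I.card + 1) * ε J.card * piCoeff Φ Δ (insert j I) i) := by gcongr
        _ = 2 ^ I.card * ε J.card * (2 * ε I.card * piCoeff Φ Δ (insert j I) i) := by
            rw [pow_succ]; ring
        _ ≤ 2 ^ I.card * ε J.card * (ε (I.card + 1) * piCoeff Φ Δ I i) := by gcongr
        _ = 2 ^ I.card * ε J.card * piCoeff Φ Δ I i * ε (I.card + 1) := by ring
    · push Not at hadj
      have h1 : piCoeff Φ Δ J i = piCoeff Φ Δ I i :=
        repr_starProjection_eq_of_orthogonal hIJ hadj _ hi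
      rw [h1]
      exact mul_le_mul_of_nonneg_right (hε.two_pow_mul_le hΦ hΔ hG hGV
        (Finset.card_pos.2 ⟨i, hi⟩) (by omega) (by simpa using J.card_le_univ))
        (piCoeff_pos hΦ hΔ hi).le

end Building

/-! ### Nested sets of subspaces -/

section NestedSubspaces

variable {V : Type*} [NormedAddCommGroup V] [InnerProductSpace ℝ V]
  {n : ℕ} {Φ : Set V} {Δ : Basis (Fin n) ℝ V} {G : Set (Submodule ℝ V)}

lemma simpleSpan_eq_top_iff {I : Finset (Fin n)} : simpleSpan Δ I = ⊤ ↔ I = Finset.univ := by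
  rw [← simpleSpan_univ (Δ := Δ), simpleSpan_injective.eq_iff]

lemma sSup_image_simpleSpan (T : Finset (Finset (Fin n))) :
    sSup (simpleSpan Δ '' (T : Set (Finset (Fin n)))) = simpleSpan Δ (T.sup id) := by
  rw [simpleSpan_sup, Finset.sup_eq_sSup_image]

lemma isAntichain_image_simpleSpan {T : Set (Finset (Fin n))} :
    IsAntichain (· ≤ ·) (simpleSpan Δ '' T) ↔ IsAntichain (· ≤ ·) T := by
  constructor
  · intro h I hI J hJ hne hle
    exact h (Set.mem_image_of_mem _ hI) (Set.mem_image_of_mem _ hJ)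
      (simpleSpan_injective.ne hne) (simpleSpan_le_simpleSpan.2 hle)
  · rintro h _ ⟨I, hI, rfl⟩ _ ⟨J, hJ, rfl⟩ hne hle
    exact h hI hJ (fun h => hne (h ▸ rfl)) (simpleSpan_le_simpleSpan.1 hle)

lemma isNested_image_iff {S : Finset (Finset (Fin n))} :
    IsNested (fund Δ G) (simpleSpan Δ '' (S : Set (Finset (Fin n)))) ↔
      IsIndexNested (indexBuilding Δ G) S := by
  constructor
  · rintro ⟨h1, h2⟩
    refine ⟨fun I hI => simpleSpan_mem_fund_iff.1 (h1 (Set.mem_image_of_mem _ hI)),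
      fun T hT hn ha hU => ?_⟩
    refine h2 (simpleSpan Δ '' (T : Set (Finset (Fin n)))) (Set.image_mono (by exact_mod_cast hT))
      (hn.image simpleSpan_injective) (isAntichain_image_simpleSpan.2 ha) ?_
    rw [sSup_image_simpleSpan]
    exact simpleSpan_mem_fund_iff.2 hU
  · rintro ⟨h1, h2⟩
    refine ⟨?_, fun T hT hn ha hU => ?_⟩
    · rintro _ ⟨I, hI, rfl⟩
      exact simpleSpan_mem_fund_iff.2 (h1 hI)
    · obtain ⟨T₀, hT₀, rfl⟩ := (Set.subset_image_iff).1 hT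
      obtain ⟨T₁, rfl⟩ : ∃ T₁ : Finset (Finset (Fin n)), (T₁ : Set (Finset (Fin n))) = T₀ :=
        ⟨(Set.toFinite T₀).toFinset, by simp⟩
      rw [sSup_image_simpleSpan] at hU
      exact h2 T₁ (by exact_mod_cast hT₀) (Set.nontrivial_of_image _ _ hn)
        (isAntichain_image_simpleSpan.1 ha) (simpleSpan_mem_fund_iff.1 hU)

lemma exists_image_eq_of_subset_fund {S : Set (Submodule ℝ V)} (hS : S ⊆ fund Δ G) :
    ∃ S₀ : Finset (Finset (Fin n)), simpleSpan Δ '' (S₀ : Set (Finset (Fin n))) = S := by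
  rw [fund_eq_image] at hS
  obtain ⟨S₀, -, rfl⟩ := Set.subset_image_iff.1 hS
  exact ⟨(Set.toFinite S₀).toFinset, by simp⟩

lemma isMaximalNested_image_iff {S : Finset (Finset (Fin n))} :
    IsMaximalNested (fund Δ G) (simpleSpan Δ '' (S : Set (Finset (Fin n)))) ↔
      Maximal (IsIndexNested (indexBuilding Δ G)) S := by
  constructor
  · intro h
    refine ⟨isNested_image_iff.1 h.prop, fun T hT hST => ?_⟩
    have h1 := h.le_of_ge (isNested_image_iff.2 hT) (Set.image_mono (by exact_mod_cast hST))
    exact_mod_cast (Set.image_subset_image_iff simpleSpan_injective).1 h1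
  · intro h
    refine ⟨isNested_image_iff.2 h.prop, fun T hT hST => ?_⟩
    obtain ⟨T₀, rfl⟩ := exists_image_eq_of_subset_fund hT.1
    have h1 : S ≤ T₀ := by
      exact_mod_cast (Set.image_subset_image_iff simpleSpan_injective).1 hST
    exact Set.image_mono (by exact_mod_cast h.le_of_ge (isNested_image_iff.1 hT) h1)

end NestedSubspaces

/-! ### The inequalities of the permutonestohedron -/

section Polytope

variable {V : Type*} [NormedAddCommGroup V] [InnerProductSpace ℝ V]

lemma mem_image_iff_inv {σ : V ≃ₗᵢ[ℝ] V} {s : Set V} {x : V} : x ∈ σ '' s ↔ σ⁻¹ x ∈ s := by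
  constructor
  · rintro ⟨y, hy, rfl⟩
    simpa using hy
  · intro h
    exact ⟨σ⁻¹ x, h, by simp⟩

variable [FiniteDimensional ℝ V]
  {n : ℕ} {Φ : Set V} {Δ : Basis (Fin n) ℝ V} {G : Set (Submodule ℝ V)} {ε : ℕ → ℝ}

lemma inner_piVec (x : V) (I : Finset (Fin n)) :
    ⟪x, piVec Φ Δ (simpleSpan Δ I)⟫ = ∑ i ∈ I, piCoeff Φ Δ I i * ⟪x, Δ i⟫ :=
  inner_eq_sum_of_mem_simpleSpan (starProjection_simpleSpan_mem _ I) x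

lemma piVec_univ : piVec Φ Δ (simpleSpan Δ Finset.univ) = delta Φ Δ :=
  starProjection_simpleSpan_univ _

lemma piVec_empty : piVec Φ Δ (simpleSpan Δ ∅) = 0 := by
  rw [piVec, simpleSpan_empty, Submodule.starProjection_bot]
  rfl

variable (Φ Δ G ε) in
/-- The inequality `(x, δ - π_J) ≤ a - ∑ ε_{dim A_i}`, where the `A_i` are the blocks of the
decomposition of the span of the simple roots with index in `J`. It covers the two families of
half-spaces in the definition of the permutonestohedron. -/
def FaceIneq (J : Finset (Fin n)) (x : V) : Prop :=
  ⟪x, delta Φ Δ - piVec Φ Δ (simpleSpan Δ J)⟫ ≤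
    ε n - ∑ I ∈ indexDecomposition (indexBuilding Δ G) J, ε I.card

lemma mem_halfSpace_top_iff (hB : IsIndexBuilding (indexBuilding Δ G)) {x : V} :
    x ∈ halfSpace Φ Δ ε ⊤ ↔ FaceIneq Φ Δ G ε ∅ x := by
  change ⟪x, deltaVec Φ Δ ⊤⟫ ≤ level n ε ⊤ ↔ _
  rw [FaceIneq, deltaVec, level, if_pos rfl, if_pos rfl, piVec_empty, sub_zero,
    indexDecomposition_empty hB, Finset.sum_empty, sub_zero]

lemma mem_halfSpace_iff {I : Finset (Fin n)} (hI : I ∈ indexBuilding Δ G) (hne : I ≠ Finset.univ)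
    {x : V} : x ∈ halfSpace Φ Δ ε (simpleSpan Δ I) ↔ FaceIneq Φ Δ G ε I x := by
  have hne' : simpleSpan Δ I ≠ ⊤ := fun h => hne (simpleSpan_eq_top_iff.1 h)
  change ⟪x, deltaVec Φ Δ _⟫ ≤ level n ε _ ↔ _
  rw [FaceIneq, deltaVec, level, if_neg hne', if_neg hne', indexDecomposition_of_mem hI,
    Finset.sum_singleton, finrank_simpleSpan]

lemma mem_halfSpaceBar_iff (hΦ : IsRootSystem Φ) (hΔ : IsSimpleSystem Φ Δ)
    (hG : IsBuildingSet Φ G) (hGV : ⊤ ∈ G) {J : Finset (Fin n)} {x : V} :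
    x ∈ halfSpaceBar Φ Δ G ε (simpleSpan Δ J) ↔ FaceIneq Φ Δ G ε J x := by
  change ⟪x, deltaBarVec Φ Δ G _⟫ ≤ levelBar Δ G ε _ ↔ _
  rw [FaceIneq, deltaBarVec, levelBar, finsum_decomposition_fund, finsum_decomposition_fund,
    ← piVec_eq_sum_indexDecomposition hΦ hΔ hG hGV]
  simp_rw [finrank_simpleSpan]

lemma mem_permutonestohedron_iff (hΦ : IsRootSystem Φ) (hΔ : IsSimpleSystem Φ Δ)
    (hG : IsBuildingSet Φ G) (hGV : ⊤ ∈ G) {x : V} :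
    x ∈ permutonestohedron Φ Δ G ε ↔
      ∀ σ ∈ weylGroup Φ, ∀ J, J ≠ Finset.univ → FaceIneq Φ Δ G ε J (σ x) := by
  have hB := hG.isIndexBuilding hΦ hΔ hGV
  simp only [permutonestohedron, Set.mem_inter_iff, Set.mem_iInter, mem_image_iff_inv]
  constructor
  · rintro ⟨h1, h2⟩ σ hσ J hJ
    have hσ' := Subgroup.inv_mem _ hσ
    rcases J.eq_empty_or_nonempty with rfl | hne
    · rw [← mem_halfSpace_top_iff hB]
      simpa using h1 σ⁻¹ hσ' ⊤ (mem_fund_iff.2 ⟨_, hB.univ_mem, simpleSpan_univ⟩)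
    by_cases hJB : J ∈ indexBuilding Δ G
    · rw [← mem_halfSpace_iff hJB hJ]
      simpa using h1 σ⁻¹ hσ' _ (simpleSpan_mem_fund_iff.2 hJB)
    · rw [← mem_halfSpaceBar_iff hΦ hΔ hG hGV]
      simpa using h2 σ⁻¹ hσ' (simpleSpan Δ J) ⟨⟨simpleSpan_mem_spannedSubspaces hΔ hne, J, rfl⟩,
        fun h => hJB (simpleSpan_mem_fund_iff.1 h)⟩
  · intro h
    refine ⟨fun σ hσ A hA => ?_, fun σ hσ A hA => ?_⟩
    · obtain ⟨I, hI, rfl⟩ := mem_fund_iff.1 hA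
      by_cases hIu : I = Finset.univ
      · rw [hIu, simpleSpan_univ, mem_halfSpace_top_iff hB]
        exact h _ (Subgroup.inv_mem _ hσ) ∅ fun h0 => by
          have := hB.nonempty _ hB.univ_mem
          simp [← h0] at this
      · rw [mem_halfSpace_iff hI hIu]
        exact h _ (Subgroup.inv_mem _ hσ) I hIu
    · obtain ⟨hA, hAG⟩ := hA
      obtain ⟨J, -, rfl⟩ := mem_fund_iff.1 hA
      rw [mem_halfSpaceBar_iff hΦ hΔ hG hGV]
      refine h _ (Subgroup.inv_mem _ hσ) J ?_
      rintro rfl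
      exact hAG (simpleSpan_mem_fund_iff.2 hB.univ_mem)

lemma apply_mem_permutonestohedron (hΦ : IsRootSystem Φ) (hΔ : IsSimpleSystem Φ Δ)
    (hG : IsBuildingSet Φ G) (hGV : ⊤ ∈ G) {σ : V ≃ₗᵢ[ℝ] V} (hσ : σ ∈ weylGroup Φ) {x : V}
    (hx : x ∈ permutonestohedron Φ Δ G ε) : σ x ∈ permutonestohedron Φ Δ G ε := by
  rw [mem_permutonestohedron_iff hΦ hΔ hG hGV] at hx ⊢
  exact fun τ hτ => hx (τ * σ) (Subgroup.mul_mem _ hτ hσ)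

lemma convex_permutonestohedron (hΦ : IsRootSystem Φ) (hΔ : IsSimpleSystem Φ Δ)
    (hG : IsBuildingSet Φ G) (hGV : ⊤ ∈ G) : Convex ℝ (permutonestohedron Φ Δ G ε) := by
  intro x hx y hy a b ha hb hab
  rw [mem_permutonestohedron_iff hΦ hΔ hG hGV] at hx hy ⊢
  intro σ hσ J hJ
  have h1 := hx σ hσ J hJ
  have h2 := hy σ hσ J hJ
  rw [FaceIneq] at h1 h2 ⊢
  rw [map_add, map_smul, map_smul, inner_add_left, real_inner_smul_left, real_inner_smul_left]
  set r := ε n - ∑ I ∈ indexDecomposition (indexBuilding Δ G) J, ε I.card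
  calc _ ≤ a * r + b * r := by gcongr
    _ = r := by rw [← add_mul, hab, one_mul]

lemma mem_hyperplane_top_iff {x : V} : x ∈ hyperplane Φ Δ ε ⊤ ↔ ⟪x, delta Φ Δ⟫ = ε n := by
  change ⟪x, deltaVec Φ Δ ⊤⟫ = level n ε ⊤ ↔ _
  rw [deltaVec, level, if_pos rfl, if_pos rfl]

lemma mem_hyperplane_iff {x : V} (hx : ⟪x, delta Φ Δ⟫ = ε n) {I : Finset (Fin n)} :
    x ∈ hyperplane Φ Δ ε (simpleSpan Δ I) ↔
      ⟪x, piVec Φ Δ (simpleSpan Δ I)⟫ = ε I.card := by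
  by_cases h : I = Finset.univ
  · rw [h, piVec_univ, simpleSpan_univ, mem_hyperplane_top_iff]
    simp
  · have h' : simpleSpan Δ I ≠ ⊤ := fun h0 => h (simpleSpan_eq_top_iff.1 h0)
    change ⟪x, deltaVec Φ Δ _⟫ = level n ε _ ↔ _
    rw [deltaVec, level, if_neg h', if_neg h', finrank_simpleSpan, inner_sub_right, hx,
      sub_right_inj]

lemma mem_nestohedron_iff {x : V} : x ∈ nestohedron Φ Δ G ε ↔ ⟪x, delta Φ Δ⟫ = ε n ∧
    ∀ I ∈ indexBuilding Δ G, ε I.card ≤ ⟪x, piVec Φ Δ (simpleSpan Δ I)⟫ := by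
  simp only [nestohedron, Set.mem_inter_iff, mem_hyperplane_top_iff, Set.mem_iInter]
  refine and_congr_right fun hx => ?_
  have key : ∀ I, I ∈ indexBuilding Δ G → I ≠ Finset.univ →
      (x ∈ halfSpace Φ Δ ε (simpleSpan Δ I) ↔
        ε I.card ≤ ⟪x, piVec Φ Δ (simpleSpan Δ I)⟫) := by
    intro I hI hne
    rw [mem_halfSpace_iff hI hne, FaceIneq, indexDecomposition_of_mem hI, Finset.sum_singleton,
      inner_sub_right, hx, sub_le_sub_iff_left]
  constructor
  · intro h I hI
    by_cases hIu : I = Finset.univ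
    · rw [hIu, piVec_univ, hx]
      simp
    · exact (key I hI hIu).1 (h _ ⟨simpleSpan_mem_fund_iff.2 hI,
        fun h0 => hIu (simpleSpan_eq_top_iff.1 h0)⟩)
  · rintro h A ⟨hA, hAt⟩
    obtain ⟨I, hI, rfl⟩ := mem_fund_iff.1 hA
    refine (key I hI ?_).2 (h I hI)
    rintro rfl
    exact hAt simpleSpan_univ

lemma nestohedron_subset_openChamber (hΦ : IsRootSystem Φ) (hΔ : IsSimpleSystem Φ Δ)
    (hG : IsBuildingSet Φ G) (hGV : ⊤ ∈ G) (hε : IsSuitable Φ Δ G ε) :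
    nestohedron Φ Δ G ε ⊆ openChamber Δ := by
  intro x hx i
  have h := (mem_nestohedron_iff.1 hx).2 {i} ((hG.isIndexBuilding hΦ hΔ hGV).singleton_mem i)
  rw [inner_piVec, Finset.sum_singleton] at h
  exact pos_of_mul_pos_right ((hε.card_pos (Finset.singleton_nonempty i)).trans_le h)
    (piCoeff_pos hΦ hΔ (Finset.mem_singleton_self i)).le

/-- Both `x` and the vectors `δ - π_J` are dominant, so that only the inequalities with `σ = 1`
have to be checked. -/
lemma nestohedron_subset_permutonestohedron (hΦ : IsRootSystem Φ) (hΔ : IsSimpleSystem Φ Δ)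
    (hG : IsBuildingSet Φ G) (hGV : ⊤ ∈ G) (hε : IsSuitable Φ Δ G ε) :
    nestohedron Φ Δ G ε ⊆ permutonestohedron Φ Δ G ε := by
  intro x hx
  rw [mem_permutonestohedron_iff hΦ hΔ hG hGV]
  intro σ hσ J _
  have hdom : ∀ i, 0 ≤ ⟪x, Δ i⟫ := fun i =>
    (nestohedron_subset_openChamber hΦ hΔ hG hGV hε hx i).le
  obtain ⟨h1, h2⟩ := mem_nestohedron_iff.1 hx
  refine (hΦ.inner_apply_le hΔ hσ hdom ((hΦ.isObtuse hΔ).inner_sub_starProjection_nonneg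
    (hΦ.inner_delta_pos hΔ) J)).trans ?_
  change ⟪x, delta Φ Δ - piVec Φ Δ (simpleSpan Δ J)⟫ ≤ _
  rw [inner_sub_right, h1, piVec_eq_sum_indexDecomposition hΦ hΔ hG hGV, inner_sum]
  exact sub_le_sub_left (Finset.sum_le_sum fun I hI =>
    h2 I (mem_indexDecomposition.1 hI).prop.1) _

/-! ### The vertices -/

/-- For a maximal nested set the hyperplanes meet in a single point, which belongs to the
nestohedron. -/
lemma exists_vertex (hΦ : IsRootSystem Φ) (hΔ : IsSimpleSystem Φ Δ) (hG : IsBuildingSet Φ G)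
    (hGV : ⊤ ∈ G) (hε : IsSuitable Φ Δ G ε) {S : Set (Submodule ℝ V)}
    (hS : IsMaximalNested (fund Δ G) S) :
    ∃ v ∈ nestohedron Φ Δ G ε, ⋂ A ∈ S, hyperplane Φ Δ ε A = {v} := by
  have hB := hG.isIndexBuilding hΦ hΔ hGV
  obtain ⟨S, rfl⟩ := exists_image_eq_of_subset_fund hS.prop.1
  rw [isMaximalNested_image_iff] at hS
  have hu := univ_mem_of_maximal hB hS
  have hc : ∀ A ∈ indexBuilding Δ G, ∀ i ∈ A, 0 < piCoeff Φ Δ A i :=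
    fun A _ i hi => piCoeff_pos hΦ hΔ hi
  obtain ⟨u, hsol, huniq⟩ := existsUnique_solution (c := piCoeff Φ Δ) (e := fun I => ε I.card)
    hB hS hc
  have hle := fun {D} hD => le_sum_of_solution (c := piCoeff Φ Δ) (e := fun I => ε I.card) hB hS hc
    (fun A hA => hε.card_pos (hB.nonempty A hA))
    (fun A _ C hC hCA i hi => hε.key hΦ hΔ hG hGV (A.card - C.card) C hC hCA.subset
      (by have := Finset.card_lt_card hCA; omega) i hi) hsol (D := D) hD
  have hmem : ∀ x, x ∈ ⋂ A ∈ simpleSpan Δ '' (S : Set (Finset (Fin n))), hyperplane Φ Δ ε A ↔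
      ∀ A ∈ S, ∑ i ∈ A, piCoeff Φ Δ A i * ⟪x, Δ i⟫ = ε A.card := by
    intro x
    simp only [Set.mem_iInter, Set.forall_mem_image, Finset.mem_coe, ← inner_piVec]
    have htop : ⟪x, delta Φ Δ⟫ = ε n ↔ x ∈ hyperplane Φ Δ ε (simpleSpan Δ Finset.univ) := by
      rw [simpleSpan_univ, mem_hyperplane_top_iff]
    constructor
    · intro h A hA
      exact (mem_hyperplane_iff (htop.2 (h hu))).1 (h hA)
    · intro h A hA
      have := h _ hu
      rw [piVec_univ, Finset.card_univ, Fintype.card_fin] at this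
      exact (mem_hyperplane_iff this).2 (h A hA)
  set v := (innerCoords Δ).symm u with hv
  have hvu : ∀ i, ⟪v, Δ i⟫ = u i := fun i => by
    rw [← innerCoords_apply, hv, LinearEquiv.apply_symm_apply]
  refine ⟨v, mem_nestohedron_iff.2 ⟨?_, fun I hI => ?_⟩, ?_⟩
  · have := hsol _ hu
    rw [← piVec_univ, inner_piVec]
    simpa [hvu] using this
  · rw [inner_piVec]
    simpa [hvu] using hle hI
  · ext x
    rw [hmem, Set.mem_singleton_iff]
    constructor
    · intro h
      rw [hv, LinearEquiv.eq_symm_apply]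
      exact huniq _ fun A hA => by simpa using h A hA
    · rintro rfl
      simpa [hvu] using hsol

lemma isBounded_permutonestohedron (hΦ : IsRootSystem Φ) (hΔ : IsSimpleSystem Φ Δ)
    (hG : IsBuildingSet Φ G) (hGV : ⊤ ∈ G) :
    Bornology.IsBounded (permutonestohedron Φ Δ G ε) := by
  have hB := hG.isIndexBuilding hΦ hΔ hGV
  obtain ⟨R, hR⟩ := ((hΦ.isObtuse hΔ).isBounded_dominant (hΦ.inner_delta_pos hΔ)
    (ε n)).exists_norm_le
  refine (isBounded_iff_forall_norm_le).2 ⟨R, fun x hx => ?_⟩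
  obtain ⟨σ, hσ, hdom⟩ := hΦ.exists_dominant hΔ x
  rw [← σ.norm_map x]
  refine hR _ ⟨hdom, ?_⟩
  have h := (mem_permutonestohedron_iff hΦ hΔ hG hGV).1 hx σ hσ ∅ fun h0 => by
    have := hB.nonempty _ hB.univ_mem
    simp [← h0] at this
  rwa [FaceIneq, piVec_empty, sub_zero, indexDecomposition_empty hB, Finset.sum_empty,
    sub_zero] at h

/-- Every linear functional attains its maximum over the permutonestohedron at one of the points
`τ v_S`: if the functional is given by `y` and `τ` is such that `τ⁻¹ y` is dominant, write `τ⁻¹ y` as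
a nonnegative combination of vectors `δ - π_J` along a chain of sets `J`, and choose `S` to contain
the decompositions of these `J`; then all the inequalities used are equalities at `v_S`. -/
lemma exists_inner_le_vertex (hΦ : IsRootSystem Φ) (hΔ : IsSimpleSystem Φ Δ)
    (hG : IsBuildingSet Φ G) (hGV : ⊤ ∈ G) {v : Set (Submodule ℝ V) → V}
    (hv : ∀ S, IsMaximalNested (fund Δ G) S → ⋂ A ∈ S, hyperplane Φ Δ ε A = {v S}) (y : V) :
    ∃ τ ∈ weylGroup Φ, ∃ S, IsMaximalNested (fund Δ G) S ∧
      ∀ x ∈ permutonestohedron Φ Δ G ε, ⟪x, y⟫ ≤ ⟪τ (v S), y⟫ := by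
  have hB := hG.isIndexBuilding hΦ hΔ hGV
  obtain ⟨σ, hσ, hdom⟩ := hΦ.exists_dominant hΔ y
  obtain ⟨F, t, hF, hFu, -, ht, hy⟩ := (hΦ.isObtuse hΔ).exists_chain_eq_sum
    (hΦ.inner_delta_pos hΔ) _ (σ y) hdom rfl
  obtain ⟨S, hFS, hS⟩ := (Set.toFinite {S | IsIndexNested (indexBuilding Δ G) S}).exists_le_maximal
    (isIndexNested_biUnion_indexDecomposition hF)
  have hS' : Maximal (IsIndexNested (indexBuilding Δ G)) S := hS
  have hSV := isMaximalNested_image_iff.2 hS'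
  have hvS := hv _ hSV
  set w := v (simpleSpan Δ '' (S : Set (Finset (Fin n))))
  have hw : w ∈ ⋂ A ∈ simpleSpan Δ '' (S : Set (Finset (Fin n))), hyperplane Φ Δ ε A := by
    rw [hvS]
    exact Set.mem_singleton w
  simp only [Set.mem_iInter, Set.forall_mem_image, Finset.mem_coe] at hw
  have hwδ : ⟪w, delta Φ Δ⟫ = ε n := by
    have := hw (univ_mem_of_maximal hB hS')
    rwa [simpleSpan_univ, mem_hyperplane_top_iff] at this
  refine ⟨σ⁻¹, Subgroup.inv_mem _ hσ, _, hSV, fun x hx => ?_⟩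
  have hinv : ∀ z, ⟪z, y⟫ = ⟪σ z, σ y⟫ := fun z => (σ.inner_map_map z y).symm
  have hσw : σ (σ⁻¹ w) = w := by simp
  rw [hinv, hinv (σ⁻¹ w), hσw, hy, inner_sum, inner_sum]
  refine Finset.sum_le_sum fun J hJ => ?_
  rw [inner_smul_right, inner_smul_right]
  refine mul_le_mul_of_nonneg_left ?_ (ht J)
  refine ((mem_permutonestohedron_iff hΦ hΔ hG hGV).1 hx σ hσ J (hFu J hJ)).trans_eq ?_
  change _ = ⟪w, delta Φ Δ - piVec Φ Δ (simpleSpan Δ J)⟫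
  rw [inner_sub_right, hwδ, piVec_eq_sum_indexDecomposition hΦ hΔ hG hGV, inner_sum]
  congr 1
  refine Finset.sum_congr rfl fun I hI => ?_
  exact ((mem_hyperplane_iff hwδ).1 (hw (hFS (Finset.mem_biUnion.2 ⟨J, hJ, hI⟩)))).symm

/-- The point `v_S` is the only point at which the inequalities of the permutonestohedron attached to
the members of `S` are equalities. -/
lemma vertex_mem_extremePoints (hΦ : IsRootSystem Φ) (hΔ : IsSimpleSystem Φ Δ)
    (hG : IsBuildingSet Φ G) (hGV : ⊤ ∈ G) (hε : IsSuitable Φ Δ G ε) {S : Set (Submodule ℝ V)}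
    (hS : IsMaximalNested (fund Δ G) S) {v : V} (hv : ⋂ A ∈ S, hyperplane Φ Δ ε A = {v}) :
    v ∈ (permutonestohedron Φ Δ G ε).extremePoints ℝ := by
  obtain ⟨w, hw, hwS⟩ := exists_vertex hΦ hΔ hG hGV hε hS
  obtain rfl : v = w := Set.singleton_injective (hv.symm.trans hwS)
  refine mem_extremePoints_iff_left.2
    ⟨nestohedron_subset_permutonestohedron hΦ hΔ hG hGV hε hw, ?_⟩
  rintro x hx z hz ⟨a, b, ha, hb, hab, hxz⟩
  have hvmem : ∀ A ∈ S, v ∈ hyperplane Φ Δ ε A := by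
    simpa using hv.symm.subset (Set.mem_singleton v)
  rw [← Set.mem_singleton_iff, ← hv]
  refine Set.mem_iInter₂.2 fun A hA => ?_
  have hhalf : ∀ p ∈ permutonestohedron Φ Δ G ε, ⟪p, deltaVec Φ Δ A⟫ ≤ level n ε A := by
    intro p hp
    have h := Set.mem_iInter₂.1 (Set.mem_iInter₂.1 hp.1 1 (Subgroup.one_mem _)) A (hS.prop.1 hA)
    exact mem_image_iff_inv.1 h
  have h1 := hhalf x hx
  have h2 := hhalf z hz
  have h3 : ⟪v, deltaVec Φ Δ A⟫ = level n ε A := hvmem A hA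
  rw [← hxz, inner_add_left, real_inner_smul_left, real_inner_smul_left] at h3
  change ⟪x, deltaVec Φ Δ A⟫ = level n ε A
  refine le_antisymm h1 (le_of_not_gt fun hlt => ?_)
  have h4 : a * ⟪x, deltaVec Φ Δ A⟫ < a * level n ε A := mul_lt_mul_of_pos_left hlt ha
  have h5 : b * ⟪z, deltaVec Φ Δ A⟫ ≤ b * level n ε A := mul_le_mul_of_nonneg_left h2 hb.le
  have h6 : a * level n ε A + b * level n ε A = level n ε A := by rw [← add_mul, hab, one_mul]
  linarith

end Polytope

end Permutonestohedron

open Permutonestohedron in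
theorem mainTheorem2 {V : Type*} [NormedAddCommGroup V] [InnerProductSpace ℝ V]
    [FiniteDimensional ℝ V] {n : ℕ} (Φ : Set V) (hΦ : Permutonestohedron.IsRootSystem Φ)
    (Δ : Module.Basis (Fin n) ℝ V) (hΔ : Permutonestohedron.IsSimpleSystem Φ Δ)
    (G : Set (Submodule ℝ V)) (hG : Permutonestohedron.IsBuildingSet Φ G)
    (hGV : (⊤ : Submodule ℝ V) ∈ G) (hGW : Permutonestohedron.IsWeylInvariant Φ G)
    (ε : ℕ → ℝ) (hε : Permutonestohedron.IsSuitable Φ Δ G ε) :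
    -- the permutonestohedron is bounded
    Bornology.IsBounded (Permutonestohedron.permutonestohedron Φ Δ G ε) ∧
    -- each `σ P_{G_fund}` lies in the open chamber `σ Ch(Δ)`
    (∀ σ ∈ Permutonestohedron.weylGroup Φ,
      σ '' Permutonestohedron.nestohedron Φ Δ G ε ⊆ σ '' Permutonestohedron.openChamber Δ) ∧
    -- the permutonestohedron is the convex hull of all of them
    Permutonestohedron.permutonestohedron Φ Δ G ε =
      convexHull ℝ (⋃ σ ∈ Permutonestohedron.weylGroup Φ,
        σ '' Permutonestohedron.nestohedron Φ Δ G ε) ∧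
    -- the points `v_S` are well defined, and the vertices are the points `σ v_S`
    ∃ v : Set (Submodule ℝ V) → V,
      (∀ S, Permutonestohedron.IsMaximalNested (Permutonestohedron.fund Δ G) S →
        ⋂ A ∈ S, Permutonestohedron.hyperplane Φ Δ ε A = {v S}) ∧
      (Permutonestohedron.permutonestohedron Φ Δ G ε).extremePoints ℝ =
        {x | ∃ σ ∈ Permutonestohedron.weylGroup Φ, ∃ S,
          Permutonestohedron.IsMaximalNested (Permutonestohedron.fund Δ G) S ∧ x = σ (v S)} := by
  choose! v hvN hv using fun S (hS : IsMaximalNested (fund Δ G) S) =>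
    exists_vertex hΦ hΔ hG hGV hε hS
  set P := permutonestohedron Φ Δ G ε with hP
  set U : Set V := {x | ∃ σ ∈ weylGroup Φ, ∃ S, IsMaximalNested (fund Δ G) S ∧ x = σ (v S)} with hU
  have hUN : U ⊆ ⋃ σ ∈ weylGroup Φ, σ '' nestohedron Φ Δ G ε := by
    rintro x ⟨σ, hσ, S, hS, rfl⟩
    exact Set.mem_iUnion₂.2 ⟨σ, hσ, Set.mem_image_of_mem _ (hvN S hS)⟩
  have hNP : (⋃ σ ∈ weylGroup Φ, σ '' nestohedron Φ Δ G ε) ⊆ P := by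
    refine Set.iUnion₂_subset fun σ hσ => ?_
    rintro _ ⟨x, hx, rfl⟩
    exact apply_mem_permutonestohedron hΦ hΔ hG hGV hσ
      (nestohedron_subset_permutonestohedron hΦ hΔ hG hGV hε hx)
  have hconv : Convex ℝ P := convex_permutonestohedron hΦ hΔ hG hGV
  have hUfin : U.Finite := by
    have hfin : {S | IsMaximalNested (fund Δ G) S}.Finite :=
      finite_fund.finite_subsets.subset fun S hS => hS.prop.1
    refine (hΦ.finite_weylGroup.image2 (fun σ S => σ (v S)) hfin).subset ?_
    rintro x ⟨σ, hσ, S, hS, rfl⟩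
    exact ⟨σ, hσ, S, hS, rfl⟩
  -- a point of `P` outside the hull of `U` would be separated from it by some vector `y`
  have hPU : P ⊆ convexHull ℝ U := by
    intro x hx
    by_contra hxU
    obtain ⟨f, r, hf, hr⟩ := geometric_hahn_banach_closed_point (convex_convexHull ℝ U)
      (hUfin.isClosed_convexHull ℝ) hxU
    obtain ⟨τ, hτ, S, hS, hle⟩ := exists_inner_le_vertex hΦ hΔ hG hGV hv
      ((InnerProductSpace.toDual ℝ V).symm f)
    have h1 := hle x hx
    rw [real_inner_comm, InnerProductSpace.toDual_symm_apply, real_inner_comm,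
      InnerProductSpace.toDual_symm_apply] at h1
    have h2 := hf (τ (v S)) (subset_convexHull ℝ U ⟨τ, hτ, S, hS, rfl⟩)
    linarith
  have hPU' : P = convexHull ℝ U :=
    hPU.antisymm (convexHull_min (hUN.trans hNP) hconv)
  refine ⟨isBounded_permutonestohedron hΦ hΔ hG hGV,
    fun σ _ => Set.image_mono (nestohedron_subset_openChamber hΦ hΔ hG hGV hε),
    (hPU.trans (convexHull_mono hUN)).antisymm (convexHull_min hNP hconv), v, hv, ?_⟩
  refine Set.Subset.antisymm ?_ ?_
  · rw [hPU']
    exact extremePoints_convexHull_subset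
  · rintro x ⟨σ, hσ, S, hS, rfl⟩
    have himage : σ '' P = P := by
      refine Set.Subset.antisymm ?_ fun x hx => mem_image_iff_inv.2
        (apply_mem_permutonestohedron hΦ hΔ hG hGV (Subgroup.inv_mem _ hσ) hx)
      rintro _ ⟨x, hx, rfl⟩
      exact apply_mem_permutonestohedron hΦ hΔ hG hGV hσ hx
    rw [← himage, ← image_extremePoints]
    exact Set.mem_image_of_mem σ (vertex_mem_extremePoints hΦ hΔ hG hGV hε hS (hv S hS))
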